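/- **Setting.** On $\mathbb C^{d_c}\times\mathbb C^{d_t}\times\mathbb C^{d_s}\times\mathbb C^{d_s}$ with complex coordinates $\phi,\chi,X_l,X_r$ let $K$ be a smooth real function on an open set $U$. Indices $c,t,l,r$ (barred: $\bar c,\bar t,\bar l,\bar r$) denote derivatives with respect to these coordinates (their conjugates), so that e.g. $K_{l\bar r}$ is the matrix of the $\partial_{X_l}\partial_{\bar X_{\bar r}}K$; capital indices denote a group with its conjugates, $X_L=(X_l,\bar X_{\bar l})$ etc., and $J=\pm i$ on unbarred/barred components. In coordinates in which the holomorphic densities $e^{f(\phi)},e^{g(\chi)}$ are $1$, the generalized Monge–Ampère equation with constant $\alpha>0$ is $$(-1)^{d_sd_c}\det\begin{pmatrix}-K_{l\bar l}&-K_{lr}&-K_{l\bar t}\\-K_{\bar r\bar l}&-K_{\bar rr}&-K_{\bar r\bar t}\\-K_{t\bar l}&-K_{tr}&-K_{t\bar t}\end{pmatrix}=\alpha\det\begin{pmatrix}K_{l\bar r}&K_{l\bar l}&K_{l\bar c}\\K_{r\bar r}&K_{r\bar l}&K_{r\bar c}\\K_{c\bar r}&K_{c\bar l}&K_{c\bar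 c}\end{pmatrix}\quad\text{on }U.\qquad(\mathrm{MA}_\alpha)$$ Call $K$ a *generalized Kähler potential* on $U$ if $U$ is connected, $\det K_{LR}\ne0$, and the metric $g$ is positive definite. Here $g$ is the symmetric tensor determined by $(B_+-g)J_+=d(-K_RJdX_R-K_CJd\phi+K_TJd\chi)$ with $B_+$ antisymmetric, and $J_+$ is the complex structure with holomorphic coordinates $\phi,\chi,X_l,K_l$. The pure spinors are $$\rho_1=d\phi^1\wedge\dots\wedge d\phi^{d_c}\wedge e^{-d(K_LdX_L)+i\,d(K_TJd\chi+K_LJdX_L-K_RJdX_R)},$$ $$\rho_2=d\chi^1\wedge\dots\wedge d\chi^{d_t}\wedge e^{-d(K_RdX_R)-i\,d(K_CJd\phi+K_LJdX_L+K_RJdX_R)}.$$ A *dilaton* is a real function $\Phi$ on $U$ such that, for suitable nonzero constants $\kappa_1,\kappa_2$, the Mukai pairings satisfy $$\kappa_1(\rho_1,\bar\rho_1)=\kappa_2(\rho_2,\bar\rho_2)=e^{-2\Phi}\,\mathrm{vol}_g .$$ **Theorem.** Let $\alpha>0$. 1. *(Kähler case, $d_s=d_t=0$.)* $(\mathrm{MA}_1)$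 is the equation $\det K_{c\bar c}=1$. If $d_c\ge1$, then $K$ satisfies $(\mathrm{MA}_\alpha)$ if and only if $\alpha^{1/d_c}K$ satisfies $\det K_{c\bar c}=1$. If a generalized Kähler potential satisfies $(\mathrm{MA}_\alpha)$, its dilatons are exactly the constant functions. 2. *($d_c=d_t=0$.)* $(\mathrm{MA}_\alpha)$ is the equation $$\det\begin{pmatrix}K_{l\bar l}&K_{lr}\\K_{\bar r\bar l}&K_{\bar rr}\end{pmatrix}=\alpha\,\det\begin{pmatrix}K_{l\bar r}&K_{l\bar l}\\K_{r\bar r}&K_{r\bar l}\end{pmatrix},$$ a one-parameter family of equations in $\alpha$: for every real $b\neq0$ and all nonzero complex constants $s_j$, $K$ satisfies $(\mathrm{MA}_\alpha)$ if and only if the function $z\mapsto b\,K(s_1z_1,s_2z_2,\dots)$, on the rescaled domain, satisfies it with the same $\alpha$. If a generalized Kähler potential satisfies $(\mathrm{MA}_\alpha)$, then the ratio below is real and nonzero, and the dilatons are exactly the functions $$\Phi=\frac12\ln\left|\frac{\det\begin{pmatrix}K_{l\bar l}&K_{lr}\\K_{\bar r\bar l}&K_{\bar rr}\end{pmatrix}}{\det\begin{pmatrix}K_{lr}&K_{l\bar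 r}\\K_{\bar lr}&K_{\bar l\bar r}\end{pmatrix}}\right|+\text{const}.$$ 3. *($d_s=0$.)* $(\mathrm{MA}_1)$ is the equation $\det K_{c\bar c}=\det(-K_{t\bar t})$. For general $\alpha$: if $d_c\ne d_t$, then $K$ satisfies $(\mathrm{MA}_\alpha)$ if and only if $\alpha^{1/(d_c-d_t)}K$ satisfies this equation; if $d_t\ge1$, then $K$ satisfies $(\mathrm{MA}_\alpha)$ if and only if $K(\phi,\mu\chi)$ with $\mu=\alpha^{-1/(2d_t)}$ satisfies this equation on the rescaled domain. If a generalized Kähler potential satisfies $(\mathrm{MA}_\alpha)$, then $\det K_{c\bar c}>0$ and the dilatons are exactly the functions $\Phi=\frac12\ln\det K_{c\bar c}+\text{const}$. 4. *($N=(4,4)$ condition.)* If $d_s=0$, $d_c=d_t$ and $K_{c\bar c}+K_{t\bar t}=0$ on $U$, then $\det K_{c\bar c}=\det(-K_{t\bar t})$ on $U$, that is, $K$ satisfies $(\mathrm{MA}_1)$. -/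

import Mathlib

namespace GenCY

noncomputable section

/-! ## Coordinates

The complex coordinates are `X_l` and `X_r` (`ds` of each), `φ` (`dc` of them) and `χ` (`dt` of
them), in this order. -/

/-- Labels of the complex coordinates `(X_l, X_r, φ, χ)`. -/
abbrev Idx (dc dt ds : ℕ) : Type := (Fin ds ⊕ Fin ds) ⊕ (Fin dc ⊕ Fin dt)

/-- The coordinate space `ℂ^ds × ℂ^ds × ℂ^dc × ℂ^dt`. -/
abbrev Pt (dc dt ds : ℕ) : Type := Idx dc dt ds → ℂ

/-- Labels for a group of `n` complex coordinates and their complex conjugates. -/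
abbrev Dbl (n : ℕ) : Type := Fin n ⊕ Fin n

/-- Labels of the coordinates together with their conjugates, in the block order
`X_L = (X_l, X̄_l)`, `X_R = (X_r, X̄_r)`, `(φ, φ̄)`, `(χ, χ̄)`. -/
abbrev Frame (dc dt ds : ℕ) : Type := (Dbl ds ⊕ Dbl ds) ⊕ (Dbl dc ⊕ Dbl dt)

variable {dc dt ds : ℕ}

def fL (a : Dbl ds) : Frame dc dt ds := Sum.inl (Sum.inl a)
def fR (a : Dbl ds) : Frame dc dt ds := Sum.inl (Sum.inr a)
def fC (a : Dbl dc) : Frame dc dt ds := Sum.inr (Sum.inl a)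
def fT (a : Dbl dt) : Frame dc dt ds := Sum.inr (Sum.inr a)

def l (i : Fin ds) : Frame dc dt ds := fL (Sum.inl i)
def lb (i : Fin ds) : Frame dc dt ds := fL (Sum.inr i)
def r (i : Fin ds) : Frame dc dt ds := fR (Sum.inl i)
def rb (i : Fin ds) : Frame dc dt ds := fR (Sum.inr i)
def c (i : Fin dc) : Frame dc dt ds := fC (Sum.inl i)
def cb (i : Fin dc) : Frame dc dt ds := fC (Sum.inr i)
def t (i : Fin dt) : Frame dc dt ds := fT (Sum.inl i)
def tb (i : Fin dt) : Frame dc dt ds := fT (Sum.inr i)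

/-- The complex coordinate underlying a frame label (forget the bar). -/
def base : Frame dc dt ds → Idx dc dt ds :=
  Sum.map (Sum.map (Sum.elim id id) (Sum.elim id id)) (Sum.map (Sum.elim id id) (Sum.elim id id))

/-- Eigenvalue of the canonical complex structure on a group of coordinates and conjugates:
`i` without a bar, `-i` with a bar. -/
def jD {n : ℕ} : Dbl n → ℂ := Sum.elim (fun _ => Complex.I) (fun _ => -Complex.I)

/-- The canonical complex structure `J`: eigenvalue `i` on unbarred and `-i` on barred labels. -/
def jF : Frame dc dt ds → ℂ := Sum.elim (Sum.elim jD jD) (Sum.elim jD jD)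

/-- The function equal to `wL, wR, wC, wT` on the four groups of labels. -/
def weight (wL wR wC wT : ℂ) : Frame dc dt ds → ℂ :=
  Sum.elim (Sum.elim (fun _ => wL) (fun _ => wR)) (Sum.elim (fun _ => wC) (fun _ => wT))

/-! ## Derivatives of the potential -/

/-- The Wirtinger derivative `∂u/∂z^A = (∂u/∂x ∓ i ∂u/∂y)/2`: sign `-` for an unbarred and `+` for
a barred label `A`. -/
def wd (A : Frame dc dt ds) (u : Pt dc dt ds → ℂ) (p : Pt dc dt ds) : ℂ :=
  (fderiv ℝ u p (Pi.single (base A) 1) - jF A * fderiv ℝ u p (Pi.single (base A) Complex.I)) / 2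

/-- First derivatives `K_A` of a real function. -/
def grad (K : Pt dc dt ds → ℝ) (A : Frame dc dt ds) : Pt dc dt ds → ℂ :=
  wd A (fun p => (K p : ℂ))

/-- The matrix of second derivatives `K_{AB} = ∂_A ∂_B K`. -/
def hess (K : Pt dc dt ds → ℝ) (p : Pt dc dt ds) : Matrix (Frame dc dt ds) (Frame dc dt ds) ℂ :=
  Matrix.of fun A B => wd A (grad K B) p

/-- `K_{LR}`. -/
def KLR (K : Pt dc dt ds → ℝ) (p : Pt dc dt ds) : Matrix (Dbl ds) (Dbl ds) ℂ :=
  (hess K p).submatrix fL fR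

/-- `K_{c c̄}`. -/
def Kcc (K : Pt dc dt ds → ℝ) (p : Pt dc dt ds) : Matrix (Fin dc) (Fin dc) ℂ :=
  (hess K p).submatrix c cb

/-- `K_{t t̄}`. -/
def Ktt (K : Pt dc dt ds → ℝ) (p : Pt dc dt ds) : Matrix (Fin dt) (Fin dt) ℂ :=
  (hess K p).submatrix t tb

/-! ## The generalized Monge-Ampère equation -/

/-- The coordinates `φ` of a point. -/
def phi (p : Pt dc dt ds) : Fin dc → ℂ := fun i => p (Sum.inr (Sum.inl i))

/-- The coordinates `χ` of a point. -/
def chi (p : Pt dc dt ds) : Fin dt → ℂ := fun i => p (Sum.inr (Sum.inr i))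

/-- The generalized Monge-Ampère equation on `U`, with constant `α` and densities `e^f`, `e^g`. -/
def GenMongeAmpere (f : (Fin dc → ℂ) → ℂ) (g : (Fin dt → ℂ) → ℂ) (α : ℝ)
    (U : Set (Pt dc dt ds)) (K : Pt dc dt ds → ℝ) : Prop :=
  ∀ p ∈ U,
    (-1) ^ (ds * dc) * Complex.exp (f (phi p)) * (starRingEnd ℂ) (Complex.exp (f (phi p))) *
        (-(hess K p).submatrix (Sum.elim l (Sum.elim rb t)) (Sum.elim lb (Sum.elim r tb))).det =
      (α : ℂ) * Complex.exp (g (chi p)) * (starRingEnd ℂ) (Complex.exp (g (chi p))) *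
        ((hess K p).submatrix (Sum.elim l (Sum.elim r c)) (Sum.elim rb (Sum.elim lb cb))).det

/-! ## Differential forms at a point and the pure spinors -/

/-- The complexified cotangent space: complex-valued real-linear forms. -/
abbrev CoT (dc dt ds : ℕ) : Type := Pt dc dt ds →L[ℝ] ℂ

/-- Complex differential forms at a point. -/
abbrev Forms (dc dt ds : ℕ) : Type := ExteriorAlgebra ℂ (CoT dc dt ds)

/-- The algebra of forms, with complex scalars acting through their conjugates. -/
def ConjForms (dc dt ds : ℕ) : Type := Forms dc dt ds

instance : Ring (ConjForms dc dt ds) := inferInstanceAs (Ring (Forms dc dt ds))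

instance : Algebra ℂ (ConjForms dc dt ds) :=
  RingHom.toAlgebra' ((algebraMap ℂ (Forms dc dt ds)).comp (starRingEnd ℂ))
    (fun a x => Algebra.commutes (A := Forms dc dt ds) ((starRingEnd ℂ) a) x)

/-- Complex conjugation of one-forms. -/
def conjCoT (m : CoT dc dt ds) : CoT dc dt ds := (Complex.conjCLE : ℂ →L[ℝ] ℂ).comp m

/-- Conjugation of one-forms, as a linear map into the conjugate algebra. -/
def conjGen : CoT dc dt ds →ₗ[ℂ] ConjForms dc dt ds where
  toFun m := (ExteriorAlgebra.ι ℂ (conjCoT m) : Forms dc dt ds)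
  map_add' m n := by
    have h : conjCoT (m + n) = conjCoT m + conjCoT n := by
      ext v; simp [conjCoT]
    rw [h]
    exact map_add _ _ _
  map_smul' a m := by
    have h : conjCoT (a • m) = (starRingEnd ℂ) a • conjCoT m := by
      ext v; simp [conjCoT]
    rw [h, map_smul, Algebra.smul_def]
    rfl

theorem conjGen_sq (m : CoT dc dt ds) : conjGen m * conjGen m = 0 :=
  ExteriorAlgebra.ι_sq_zero (R := ℂ) (conjCoT m)

/-- Complex conjugation of forms, as a homomorphism into the conjugate algebra. -/
def conjHom : Forms dc dt ds →ₐ[ℂ] ConjForms dc dt ds :=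
  ExteriorAlgebra.lift ℂ ⟨conjGen, conjGen_sq⟩

/-- Complex conjugation of forms: the conjugate-linear ring homomorphism that conjugates every
one-form. -/
def conjForm (ω : Forms dc dt ds) : Forms dc dt ds := (conjHom ω : ConjForms dc dt ds)

theorem conjForm_one_form (m : CoT dc dt ds) :
    conjForm (ExteriorAlgebra.ι ℂ m) = ExteriorAlgebra.ι ℂ (conjCoT m) := by
  have h : conjHom (ExteriorAlgebra.ι ℂ m) = conjGen m := by
    unfold conjHom
    rw [ExteriorAlgebra.lift_ι_apply]
  exact h

theorem conjForm_mul (x y : Forms dc dt ds) : conjForm (x * y) = conjForm x * conjForm y :=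
  map_mul conjHom x y

theorem conjForm_add (x y : Forms dc dt ds) : conjForm (x + y) = conjForm x + conjForm y :=
  map_add conjHom x y

theorem conjForm_smul (a : ℂ) (x : Forms dc dt ds) :
    conjForm (a • x) = (starRingEnd ℂ) a • conjForm x := by
  have h : conjHom (a • x) = algebraMap ℂ (ConjForms dc dt ds) a * conjHom x := by
    rw [map_smul, Algebra.smul_def]
  have h' : (starRingEnd ℂ) a • conjForm x =
      algebraMap ℂ (Forms dc dt ds) ((starRingEnd ℂ) a) * conjForm x := Algebra.smul_def _ _
  rw [h']
  exact h

/-- The coordinate one-forms `dz^A` (with `dz̄` on barred labels). -/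
def dz (A : Frame dc dt ds) : CoT dc dt ds :=
  Sum.elim
    (Sum.elim
      (Sum.elim (fun i => ContinuousLinearMap.proj (R := ℝ) (Sum.inl (Sum.inl i)))
        (fun i => conjCoT (ContinuousLinearMap.proj (R := ℝ) (Sum.inl (Sum.inl i)))))
      (Sum.elim (fun i => ContinuousLinearMap.proj (R := ℝ) (Sum.inl (Sum.inr i)))
        (fun i => conjCoT (ContinuousLinearMap.proj (R := ℝ) (Sum.inl (Sum.inr i))))))
    (Sum.elim
      (Sum.elim (fun i => ContinuousLinearMap.proj (R := ℝ) (Sum.inr (Sum.inl i)))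
        (fun i => conjCoT (ContinuousLinearMap.proj (R := ℝ) (Sum.inr (Sum.inl i)))))
      (Sum.elim (fun i => ContinuousLinearMap.proj (R := ℝ) (Sum.inr (Sum.inr i)))
        (fun i => conjCoT (ContinuousLinearMap.proj (R := ℝ) (Sum.inr (Sum.inr i)))))) A

/-- The exterior derivative at `p` of the one-form `∑_A w_A K_A dz^A` with constants `w_A`, namely
`∑_A w_A d(K_A) ∧ dz^A`. -/
def dForm (K : Pt dc dt ds → ℝ) (w : Frame dc dt ds → ℂ) (p : Pt dc dt ds) : Forms dc dt ds :=
  ∑ A, w A • (ExteriorAlgebra.ι ℂ (fderiv ℝ (grad K A) p) * ExteriorAlgebra.ι ℂ (dz A))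

/-- The real dimension `D` of the coordinate space. -/
def realDim (dc dt ds : ℕ) : ℕ := 2 * (dc + dt + 2 * ds)

/-- The exponential `∑ ω^k / k!` of a two-form (the powers with `2k > D` vanish). -/
def expForm (ω : Forms dc dt ds) : Forms dc dt ds :=
  ∑ k ∈ Finset.range (realDim dc dt ds + 1), ((k.factorial : ℂ)⁻¹) • ω ^ k

/-- `ρ₁ = e^f dφ¹ ∧ … ∧ dφ^dc ∧ exp(R₁ + i S₁)`, where `R₁ = -d(K_L dX_L)` and
`S₁ = d(K_T J dχ + K_L J dX_L - K_R J dX_R)`. -/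
def spinor₁ (f : (Fin dc → ℂ) → ℂ) (K : Pt dc dt ds → ℝ) (p : Pt dc dt ds) : Forms dc dt ds :=
  Complex.exp (f (phi p)) •
    (((List.finRange dc).map fun i => ExteriorAlgebra.ι ℂ (dz (c i : Frame dc dt ds))).prod *
      expForm (-dForm K (weight 1 0 0 0) p +
        Complex.I • dForm K (jF * weight 1 (-1) 0 1) p))

/-- `ρ₂ = e^g dχ¹ ∧ … ∧ dχ^dt ∧ exp(R₂ + i S₂)`, where `R₂ = -d(K_R dX_R)` and
`S₂ = -d(K_C J dφ + K_L J dX_L + K_R J dX_R)`. -/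
def spinor₂ (g : (Fin dt → ℂ) → ℂ) (K : Pt dc dt ds → ℝ) (p : Pt dc dt ds) : Forms dc dt ds :=
  Complex.exp (g (chi p)) •
    (((List.finRange dt).map fun i => ExteriorAlgebra.ι ℂ (dz (t i : Frame dc dt ds))).prod *
      expForm (-dForm K (weight 0 1 0 0) p +
        Complex.I • (-dForm K (jF * weight 1 1 1 0) p)))

/-- The homogeneous component of degree `k` of a form. -/
def degreePart (k : ℕ) (ω : Forms dc dt ds) : Forms dc dt ds :=
  GradedRing.proj (fun i : ℕ => ⋀[ℂ]^i (CoT dc dt ds)) k ω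

/-- The Mukai pairing `∑_j (-1)^j (ρ^{2j} ∧ σ^{D-2j} + ρ^{2j+1} ∧ σ^{D-2j-1})`, a form of top
degree. -/
def mukai (ρ σ : Forms dc dt ds) : Forms dc dt ds :=
  ∑ k ∈ Finset.range (realDim dc dt ds + 1),
    (-1) ^ (k / 2) * (degreePart k ρ * degreePart (realDim dc dt ds - k) σ)

/-! ## The metric, and the dilaton -/

/-- The components of the two-form `d(∑_A w_A K_A dz^A)` in the frame `dz^A`. -/
def dMatrix (K : Pt dc dt ds → ℝ) (w : Frame dc dt ds → ℂ) (p : Pt dc dt ds) :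
    Matrix (Frame dc dt ds) (Frame dc dt ds) ℂ :=
  Matrix.of fun A B => hess K p A B * (w B - w A)

/-- The matrix `C_{L•} = J K_{L•} - K_{L•} J`, for a group of `n` coordinates. -/
def commL {n : ℕ} (M : Matrix (Dbl ds) (Dbl n) ℂ) : Matrix (Dbl ds) (Dbl n) ℂ :=
  Matrix.diagonal jD * M - M * Matrix.diagonal jD

/-- The complex structure `J₊` in the frame `(X_L, X_R, φ, χ)`. -/
def Jplus (K : Pt dc dt ds → ℝ) (p : Pt dc dt ds) :
    Matrix (Frame dc dt ds) (Frame dc dt ds) ℂ :=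
  Matrix.fromBlocks
    (Matrix.fromBlocks (Matrix.diagonal jD) 0
      ((KLR K p)⁻¹ * commL ((hess K p).submatrix fL fL))
      ((KLR K p)⁻¹ * Matrix.diagonal jD * KLR K p))
    (Matrix.fromBlocks 0 0
      ((KLR K p)⁻¹ * commL ((hess K p).submatrix fL fC))
      ((KLR K p)⁻¹ * commL ((hess K p).submatrix fL fT)))
    0
    (Matrix.fromBlocks (Matrix.diagonal jD) 0 0 (Matrix.diagonal jD))

/-- The metric in the complex frame. It is determined by
`(B₊ - g) J₊ = d(-K_R J dX_R - K_C J dφ + K_T J dχ)` with `B₊` antisymmetric, `g` symmetric and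
`J₊² = -1`: it is the symmetric part of the right-hand side times `J₊`. -/
def frameMetric (K : Pt dc dt ds → ℝ) (p : Pt dc dt ds) :
    Matrix (Frame dc dt ds) (Frame dc dt ds) ℂ :=
  (1 / 2 : ℂ) • (dMatrix K (jF * weight 0 (-1) (-1) 1) p * Jplus K p +
    (dMatrix K (jF * weight 0 (-1) (-1) 1) p * Jplus K p).transpose)

/-- The coordinate vector fields `∂/∂x^j` (label `(j, 0)`) and `∂/∂y^j` (label `(j, 1)`). -/
def realVec (m : Idx dc dt ds × Fin 2) : Pt dc dt ds :=
  Pi.single m.1 (if m.2 = 0 then 1 else Complex.I)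

/-- The metric `g_{μν}` in the real coordinates `x^j, y^j`. -/
def metric (K : Pt dc dt ds → ℝ) (p : Pt dc dt ds) :
    Matrix (Idx dc dt ds × Fin 2) (Idx dc dt ds × Fin 2) ℝ :=
  Matrix.of fun m n =>
    (∑ A, ∑ B, frameMetric K p A B * dz A (realVec m) * dz B (realVec n)).re

/-- `K` is a generalized Kähler potential on the connected open set `U`: smooth, with `K_{LR}`
invertible and the metric positive definite. -/
structure IsPotential (U : Set (Pt dc dt ds)) (K : Pt dc dt ds → ℝ) : Prop where
  isOpen : IsOpen U
  connected : IsPreconnected U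
  smooth : ContDiffOn ℝ ((⊤ : ℕ∞) : WithTop ℕ∞) K U
  det_ne : ∀ p ∈ U, (KLR K p).det ≠ 0
  posDef : ∀ p ∈ U, (metric K p).PosDef

/-- The real part of a coordinate one-form: `dx^A`. -/
def dx (A : Frame dc dt ds) : CoT dc dt ds :=
  ((Complex.ofRealCLM : ℝ →L[ℝ] ℂ).comp (Complex.reCLM : ℂ →L[ℝ] ℝ)).comp (dz A)

/-- The imaginary part of a coordinate one-form: `dy^A`. -/
def dy (A : Frame dc dt ds) : CoT dc dt ds :=
  ((Complex.ofRealCLM : ℝ →L[ℝ] ℂ).comp (Complex.imCLM : ℂ →L[ℝ] ℝ)).comp (dz A)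

/-- The wedge product of `dx^i ∧ dy^i` over a group of coordinates. -/
def areaProd {n : ℕ} (e : Fin n → Frame dc dt ds) : Forms dc dt ds :=
  ((List.finRange n).map fun i =>
    ExteriorAlgebra.ι ℂ (dx (e i)) * ExteriorAlgebra.ι ℂ (dy (e i))).prod

/-- The coordinate volume form, the wedge product of all `dx^j ∧ dy^j`. -/
def coordVol (dc dt ds : ℕ) : Forms dc dt ds :=
  areaProd l * areaProd r * areaProd c * areaProd t

/-- `Φ` is a dilaton on `U`: the pure spinors, each normalized by a suitable nonzero constant,
satisfy `(ρ₁, ρ̄₁) = (ρ₂, ρ̄₂) = e^{-2Φ} √(det g) dx¹ ∧ … ∧ dx^D`. -/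
def IsDilaton (f : (Fin dc → ℂ) → ℂ) (g : (Fin dt → ℂ) → ℂ) (U : Set (Pt dc dt ds))
    (K : Pt dc dt ds → ℝ) (Φ : Pt dc dt ds → ℝ) : Prop :=
  ∃ κ₁ κ₂ : ℂ, κ₁ ≠ 0 ∧ κ₂ ≠ 0 ∧ ∀ p ∈ U,
    κ₁ • mukai (spinor₁ f K p) (conjForm (spinor₁ f K p)) =
      ((Real.exp (-2 * Φ p) * Real.sqrt (metric K p).det : ℝ) : ℂ) • coordVol dc dt ds ∧
    κ₂ • mukai (spinor₂ g K p) (conjForm (spinor₂ g K p)) =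
      ((Real.exp (-2 * Φ p) * Real.sqrt (metric K p).det : ℝ) : ℂ) • coordVol dc dt ds

/-! ## Rescalings of the coordinates -/

/-- The rescaling `z^j ↦ s_j z^j` of the coordinates. -/
def scale (s : Idx dc dt ds → ℂ) (p : Pt dc dt ds) : Pt dc dt ds := fun j => s j * p j

/-- The rescaling `(φ, χ) ↦ (φ, μ χ)` of the coordinates `χ`. -/
def scaleChi (μ : ℝ) : Pt dc dt ds → Pt dc dt ds :=
  scale (Sum.elim (fun _ => 1) (Sum.elim (fun _ => 1) (fun _ => (μ : ℂ))))

/-! ## The determinants of the case `dc = dt = 0` -/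

/-- The determinant with rows `(l, r̄)` and columns `(l̄, r)`. -/
def detA (K : Pt dc dt ds → ℝ) (p : Pt dc dt ds) : ℂ :=
  (Matrix.fromBlocks ((hess K p).submatrix l lb) ((hess K p).submatrix l r)
    ((hess K p).submatrix rb lb) ((hess K p).submatrix rb r)).det

/-- The determinant with rows `(l, r)` and columns `(r̄, l̄)`. -/
def detB (K : Pt dc dt ds → ℝ) (p : Pt dc dt ds) : ℂ :=
  (Matrix.fromBlocks ((hess K p).submatrix l rb) ((hess K p).submatrix l lb)
    ((hess K p).submatrix r rb) ((hess K p).submatrix r lb)).det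

end

end GenCY

open GenCY

/-! Everything reduces to three determinants. Write a pure spinor as `P * exp (R + i S)`, with `P` a
product of holomorphic one-forms and `R`, `S` real two-forms. The signs in the Mukai pairing turn
one exponential into its inverse, so pairing the spinor with its conjugate leaves a constant times
`P P̄ (-2 i S)^n`, and `R` drops out (`mukai_mul_expForm`, `mukai_spinor`). Modulo the factors of `P
P̄`, the symmetry of `K_{AB}` makes `S` pair only labels of opposite weight (`listForm_mul_dForm`),
and the top power of such a two-form is a determinant (`sum_ι_mul_ι_pow`). Hence the two pairings
are nonzero constants, depending on the dimensions only, times `det leftMatrix` and `det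
rightMatrix`. These are the determinants on the two sides of the Monge-Ampère equation, so the
equation makes the pairings proportional, and the free constants `κ₁`, `κ₂` absorb every numerical
factor.

The third determinant is that of the metric. In the purely semichiral case the symmetrized product
defining `g` factors as `[J ⊕ J, H]`, times an antidiagonal matrix built from `K_{LR}⁻¹`, times `[J
⊕ -J, H]`, where `H` is the Hessian (`block_metric_factor`). The commutators again pair labels of
opposite weight, with determinants proportional to `detB ^ 2` and `detA ^ 2`, so `det g * (det
K_{LR}) ^ 2` is a constant times `(detA * detB) ^ 2`. Without semichiral coordinates `J₊` is
diagonal, and `det g` is a constant times `(det K_{cc̄} * det K_{tt̄}) ^ 2`.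

Under the Monge-Ampère equation both pairings are then constants times one positive function `u`,
while `√(det g)` is a constant times `u q`. Cancelling `u` makes `e^{-2Φ} q` constant, which gives
`Φ = (1/2) log q` up to a constant (`isDilaton_iff_log`). In the semichiral case `u` is `|detA|`,
and connectedness of `U` fixes the sign of `detA`; in the other case `u = q = det K_{cc̄}`, positive
because `g` is positive on chiral vectors. The rescaling statements count how often each label
occurs in each determinant. -/

namespace GenCY

variable {dc dt ds : ℕ}

/-! ## Labels and coordinate one-forms -/

/-- Conjugation of labels: add or remove the bar. -/
def bar : Frame dc dt ds ≃ Frame dc dt ds :=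
  Equiv.sumCongr (Equiv.sumCongr (Equiv.sumComm _ _) (Equiv.sumComm _ _))
    (Equiv.sumCongr (Equiv.sumComm _ _) (Equiv.sumComm _ _))

/-- The unbarred label of a coordinate. -/
def unbarred : Idx dc dt ds → Frame dc dt ds :=
  Sum.map (Sum.map Sum.inl Sum.inl) (Sum.map Sum.inl Sum.inl)

@[simp] theorem base_bar (A : Frame dc dt ds) : base (bar A) = base A := by
  rcases A with ((_ | _) | (_ | _)) | ((_ | _) | (_ | _)) <;> rfl

@[simp] theorem base_unbarred (j : Idx dc dt ds) : base (unbarred j) = j := by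
  rcases j with (_ | _) | (_ | _) <;> rfl

@[simp] theorem jF_unbarred (j : Idx dc dt ds) : jF (unbarred j) = Complex.I := by
  rcases j with (_ | _) | (_ | _) <;> rfl

@[simp] theorem jF_bar (A : Frame dc dt ds) : jF (bar A) = -jF A := by
  rcases A with ((_ | _) | (_ | _)) | ((_ | _) | (_ | _)) <;> simp [bar, jF, jD]

@[simp] theorem conj_jF (A : Frame dc dt ds) : (starRingEnd ℂ) (jF A) = -jF A := by
  rcases A with ((_ | _) | (_ | _)) | ((_ | _) | (_ | _)) <;> simp [jF, jD]

@[simp] theorem jF_mul_self (A : Frame dc dt ds) : jF A * jF A = -1 := by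
  rcases A with ((_ | _) | (_ | _)) | ((_ | _) | (_ | _)) <;> simp [jF, jD]

theorem sum_frame {M : Type*} [AddCommMonoid M] (F : Frame dc dt ds → M) :
    ∑ A, F A = ∑ j, (F (unbarred j) + F (bar (unbarred j))) := by
  simp only [Fintype.sum_sum_type, Finset.sum_add_distrib, unbarred, bar, Sum.map_inl, Sum.map_inr,
    Equiv.sumCongr_apply, Equiv.sumComm_apply, Sum.swap_inl]
  abel

theorem eq_or_eq_bar {A B : Frame dc dt ds} (h : base A = base B) : A = B ∨ A = bar B := by
  rcases A with ((_ | _) | (_ | _)) | ((_ | _) | (_ | _)) <;>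
    rcases B with ((_ | _) | (_ | _)) | ((_ | _) | (_ | _)) <;>
    simp_all [base, bar]

theorem dz_apply (A : Frame dc dt ds) (v : Pt dc dt ds) :
    dz A v = (v (base A)).re + jF A * (v (base A)).im := by
  have h (z : ℂ) : z = z.re + Complex.I * z.im := by rw [mul_comm, Complex.re_add_im]
  have h' (z : ℂ) : (starRingEnd ℂ) z = z.re + -Complex.I * z.im := by
    apply Complex.ext <;> simp
  rcases A with ((_ | _) | (_ | _)) | ((_ | _) | (_ | _)) <;> first | exact h _ | exact h' _

theorem conjCoT_dz (A : Frame dc dt ds) : conjCoT (dz A) = dz (bar A) := by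
  ext v
  have : conjCoT (dz A) v = (starRingEnd ℂ) (dz A v) := rfl
  rw [this, dz_apply, dz_apply]
  simp

theorem conj_dz (A : Frame dc dt ds) (v : Pt dc dt ds) :
    (starRingEnd ℂ) (dz A v) = dz (bar A) v := by
  rw [← conjCoT_dz]; rfl

/-- The component of a one-form along `dz^A`. -/
noncomputable def coeff (A : Frame dc dt ds) : CoT dc dt ds →ₗ[ℂ] ℂ where
  toFun m := (m (Pi.single (base A) 1) - jF A * m (Pi.single (base A) Complex.I)) / 2
  map_add' m n := by simp; ring
  map_smul' a m := by simp; ring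

theorem coeff_apply (A : Frame dc dt ds) (m : CoT dc dt ds) : coeff A m =
    (m (Pi.single (base A) 1) - jF A * m (Pi.single (base A) Complex.I)) / 2 := rfl

theorem wd_eq_coeff (A : Frame dc dt ds) (u : Pt dc dt ds → ℂ) (p : Pt dc dt ds) :
    wd A u p = coeff A (fderiv ℝ u p) := rfl

/-- The functionals `coeff A` are dual to the forms `dz A`; this yields linear independence, and
`sum_coeff_smul_dz` yields spanning. -/
theorem coeff_dz (A B : Frame dc dt ds) : coeff A (dz B) = if A = B then 1 else 0 := by
  rw [coeff_apply, dz_apply, dz_apply]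
  by_cases h : base A = base B
  · rcases eq_or_eq_bar h with rfl | rfl
    · simp
    -- A label fixed by `bar` would have a `J`-eigenvalue equal to its own negative, contradicting
    -- square `-1`.
    · have : bar B ≠ B := fun h' => by
        have h1 := jF_bar B
        rw [h'] at h1
        have h2 := jF_mul_self B
        have : jF B = 0 := by linear_combination h1 / 2
        simp [this] at h2
      simp [this]
  · have : A ≠ B := fun h' => h (h' ▸ rfl)
    simp [this, Ne.symm h]

theorem sum_coeff_smul_dz (m : CoT dc dt ds) : ∑ A, coeff A m • dz A = m := by
  ext v
  -- The form `m` is only real-linear, so `v` is expanded over the real basis of the vectors `e_j`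
  -- and `i e_j`.
  have hv : v = ∑ j, ((v j).re • (Pi.single j 1 : Pt dc dt ds) +
      (v j).im • (Pi.single j Complex.I : Pt dc dt ds)) := by
    ext k
    rw [Finset.sum_apply, Finset.sum_eq_single k (fun j _ hj => by simp [hj.symm]) (by simp)]
    simp
  conv_rhs => rw [hv]
  rw [sum_frame, map_sum, sum_apply]
  refine Finset.sum_congr rfl fun j _ => ?_
  simp only [add_apply, smul_apply, map_add, map_smul,
    coeff_apply, dz_apply, base_bar, base_unbarred, jF_bar, jF_unbarred]
  simp only [smul_eq_mul, Complex.real_smul]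
  linear_combination (-(((v j).im : ℂ) * m (Pi.single j Complex.I))) * Complex.I_sq

/-- The coordinate one-forms form a basis of the complexified cotangent space. -/
noncomputable def dzBasis : Module.Basis (Frame dc dt ds) ℂ (CoT dc dt ds) :=
  Module.Basis.mk (v := dz)
    (linearIndependent_iff'.2 fun s g hg A hA => by
      have := congrArg (coeff A) hg
      simpa [coeff_dz, hA] using this)
    (fun m _ => by
      rw [← sum_coeff_smul_dz m]
      exact Submodule.sum_mem _ fun A _ => Submodule.smul_mem _ _ (Submodule.subset_span ⟨A, rfl⟩))

@[simp] theorem dzBasis_apply (A : Frame dc dt ds) : dzBasis A = dz A := by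
  simp [dzBasis]

/-! ## Second derivatives of the potential -/

theorem grad_eq {K : Pt dc dt ds → ℝ} {p : Pt dc dt ds} (h : DifferentiableAt ℝ K p)
    (A : Frame dc dt ds) :
    grad K A p = ((fderiv ℝ K p (Pi.single (base A) 1) : ℂ) -
      jF A * (fderiv ℝ K p (Pi.single (base A) Complex.I) : ℂ)) / 2 := by
  have h1 : HasFDerivAt (fun p => (K p : ℂ)) (Complex.ofRealCLM.comp (fderiv ℝ K p)) p :=
    Complex.ofRealCLM.hasFDerivAt.comp p h.hasFDerivAt
  rw [grad, wd, h1.fderiv]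
  simp

section Smooth

variable {U : Set (Pt dc dt ds)} {K : Pt dc dt ds → ℝ} {p : Pt dc dt ds}

theorem fderiv_grad_apply (hK : ContDiffAt ℝ 2 K p) (B : Frame dc dt ds) (v : Pt dc dt ds) :
    fderiv ℝ (grad K B) p v =
      ((fderiv ℝ (fderiv ℝ K) p v (Pi.single (base B) 1) : ℂ) -
        jF B * (fderiv ℝ (fderiv ℝ K) p v (Pi.single (base B) Complex.I) : ℂ)) / 2 := by
  -- The formula for `grad` has to hold on a neighbourhood of `p` before it can be differentiated
  -- there.
  have h1 : ∀ᶠ q in nhds p, DifferentiableAt ℝ K q :=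
    (hK.eventually (by simp)).mono fun q hq => hq.differentiableAt (by norm_num)
  have h2 : grad K B =ᶠ[nhds p] fun q => ((fderiv ℝ K q (Pi.single (base B) 1) : ℂ) -
      jF B * (fderiv ℝ K q (Pi.single (base B) Complex.I) : ℂ)) / 2 :=
    h1.mono fun q hq => grad_eq hq B
  have h3 : DifferentiableAt ℝ (fderiv ℝ K) p :=
    (hK.fderiv_right (m := 1) (by norm_num)).differentiableAt (by norm_num)
  have h4 (w : Pt dc dt ds) : HasFDerivAt (fun q => (fderiv ℝ K q w : ℂ))
      (Complex.ofRealCLM.comp ((ContinuousLinearMap.apply ℝ ℝ w).comp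
        (fderiv ℝ (fderiv ℝ K) p))) p :=
    Complex.ofRealCLM.hasFDerivAt.comp p
      ((ContinuousLinearMap.apply ℝ ℝ w).hasFDerivAt.comp p h3.hasFDerivAt)
  have h5 := ((h4 (Pi.single (base B) 1)).sub
    ((h4 (Pi.single (base B) Complex.I)).const_mul (jF B))).mul_const (2 : ℂ)⁻¹
  rw [h2.fderiv_eq]
  simp only [div_eq_mul_inv]
  have h6 := h5.fderiv
  simp only [Pi.sub_apply] at h6
  erw [h6]
  simp
  ring

/-- In terms of real second derivatives, symmetry of mixed partials gives `hess_symm`, and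
conjugation only changes the sign of the `jF` factors, which gives `conj_hess`. -/
theorem hess_eq (hK : ContDiffAt ℝ 2 K p) (A B : Frame dc dt ds) :
    hess K p A B =
      ((fderiv ℝ (fderiv ℝ K) p (Pi.single (base A) 1) (Pi.single (base B) 1) : ℂ) -
        jF B * (fderiv ℝ (fderiv ℝ K) p (Pi.single (base A) 1) (Pi.single (base B) Complex.I) : ℂ) -
        jF A * ((fderiv ℝ (fderiv ℝ K) p (Pi.single (base A) Complex.I) (Pi.single (base B) 1) : ℂ) -
        jF B * (fderiv ℝ (fderiv ℝ K) p (Pi.single (base A) Complex.I)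
          (Pi.single (base B) Complex.I) : ℂ))) / 4 := by
  have : hess K p A B = (fderiv ℝ (grad K B) p (Pi.single (base A) 1) -
      jF A * fderiv ℝ (grad K B) p (Pi.single (base A) Complex.I)) / 2 := rfl
  rw [this, fderiv_grad_apply hK, fderiv_grad_apply hK]
  ring

theorem hess_symm (hK : ContDiffAt ℝ 2 K p) (A B : Frame dc dt ds) :
    hess K p A B = hess K p B A := by
  have h := hK.isSymmSndFDerivAt (by simp)
  rw [hess_eq hK, hess_eq hK, h.eq (Pi.single (base B) 1) (Pi.single (base A) 1),
    h.eq (Pi.single (base B) 1) (Pi.single (base A) Complex.I),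
    h.eq (Pi.single (base B) Complex.I) (Pi.single (base A) 1),
    h.eq (Pi.single (base B) Complex.I) (Pi.single (base A) Complex.I)]
  ring

theorem conj_hess (hK : ContDiffAt ℝ 2 K p) (A B : Frame dc dt ds) :
    (starRingEnd ℂ) (hess K p A B) = hess K p (bar A) (bar B) := by
  rw [hess_eq hK, hess_eq hK]
  have h4 : (starRingEnd ℂ) 4 = 4 := map_ofNat _ 4
  simp only [map_div₀, map_sub, map_mul, conj_jF, Complex.conj_ofReal, base_bar, jF_bar, h4]

theorem contDiffAt_two (hU : IsOpen U) (hK : ContDiffOn ℝ ((⊤ : ℕ∞) : WithTop ℕ∞) K U)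
    (hp : p ∈ U) : ContDiffAt ℝ 2 K p :=
  (hK.contDiffAt (hU.mem_nhds hp)).of_le (WithTop.coe_le_coe.2 (le_top : (2 : ℕ∞) ≤ ⊤))

theorem continuousOn_hess (hU : IsOpen U) (hK : ContDiffOn ℝ ((⊤ : ℕ∞) : WithTop ℕ∞) K U)
    (A B : Frame dc dt ds) : ContinuousOn (fun p => hess K p A B) U := by
  have h1 : ContDiffOn ℝ 1 (fderiv ℝ K) U :=
    hK.fderiv_of_isOpen hU (WithTop.coe_le_coe.2 (le_top : (2 : ℕ∞) ≤ ⊤))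
  have h2 : ContinuousOn (fderiv ℝ (fderiv ℝ K)) U :=
    h1.continuousOn_fderiv_of_isOpen hU (by norm_num)
  have h3 (v w : Pt dc dt ds) :
      ContinuousOn (fun p => (fderiv ℝ (fderiv ℝ K) p v w : ℂ)) U :=
    Complex.continuous_ofReal.comp_continuousOn ((h2.clm_apply continuousOn_const).clm_apply
      continuousOn_const)
  refine ContinuousOn.congr (f := fun p => _) ?_ fun p hp =>
    hess_eq (contDiffAt_two hU hK hp) A B
  exact (((h3 _ _).sub (continuousOn_const.mul (h3 _ _))).sub (continuousOn_const.mul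
    ((h3 _ _).sub (continuousOn_const.mul (h3 _ _))))).div_const _

end Smooth

/-- No smoothness is needed: the entries of `hess` are by definition the components of the
differential of `grad K A`. -/
theorem fderiv_grad_eq_sum (K : Pt dc dt ds → ℝ) (p : Pt dc dt ds) (A : Frame dc dt ds) :
    fderiv ℝ (grad K A) p = ∑ B, hess K p B A • dz B :=
  (sum_coeff_smul_dz _).symm

/-! ## Rescalings -/

theorem hess_const_mul (b : ℝ) (K : Pt dc dt ds → ℝ) (p : Pt dc dt ds) :
    hess (fun q => b * K q) p = (b : ℂ) • hess K p := by
  have h (u : Pt dc dt ds → ℂ) (A : Frame dc dt ds) (q : Pt dc dt ds) :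
      wd A (fun p => (b : ℂ) * u p) q = b * wd A u q := by
    rw [wd_eq_coeff, wd_eq_coeff]
    have : fderiv ℝ (fun p => (b : ℂ) * u p) q = (b : ℂ) • fderiv ℝ u q :=
      congrFun (fderiv_const_smul_field (𝕜 := ℝ) (f := u) (b : ℂ)) q
    rw [this, map_smul, smul_eq_mul]
  ext A B
  have h1 : grad (fun q => b * K q) B = fun q => (b : ℂ) * grad K B q := by
    funext q
    rw [grad, grad, ← h]
    simp
  simp only [hess, Matrix.of_apply, Matrix.smul_apply, smul_eq_mul]
  rw [h1, h]

/-- The factor by which `∂_A` rescales under `scale s`. -/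
noncomputable def scaleFactor (s : Idx dc dt ds → ℂ) (A : Frame dc dt ds) : ℂ :=
  (s (base A)).re + jF A * (s (base A)).im

/-- Multiplication by `s j` is holomorphic, so an unbarred derivative acquires `s j` and a barred
one its conjugate. Since the rescaling is a linear equivalence, the chain rule holds without
differentiability of `u`. -/
theorem wd_comp_scale {s : Idx dc dt ds → ℂ} (hs : ∀ j, s j ≠ 0) (u : Pt dc dt ds → ℂ)
    (A : Frame dc dt ds) (p : Pt dc dt ds) :
    wd A (fun q => u (scale s q)) p = scaleFactor s A * wd A u (scale s p) := by
  let e : Pt dc dt ds ≃L[ℝ] Pt dc dt ds :=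
    ContinuousLinearEquiv.piCongrRight fun j =>
      ContinuousLinearEquiv.restrictScalars ℝ (ContinuousLinearEquiv.unitsEquivAut ℂ
        (Units.mk0 (s j) (hs j)))
  have he : (fun q => u (scale s q)) = u ∘ e := by
    funext q
    simp only [Function.comp]
    congr 1
    ext j
    simp [e, scale, mul_comm]
  have he' : e p = scale s p := by
    ext j
    simp [e, scale, mul_comm]
  have hv (z : ℂ) : e (Pi.single (base A) z) =
      (s (base A) * z).re • (Pi.single (base A) 1 : Pt dc dt ds) +
      (s (base A) * z).im • (Pi.single (base A) Complex.I : Pt dc dt ds) := by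
    ext j
    by_cases hj : j = base A
    · subst hj
      simp only [e, ContinuousLinearEquiv.piCongrRight_apply, Pi.single_eq_same, Pi.add_apply,
        Pi.smul_apply]
      simp only [Complex.real_smul, mul_one]
      rw [Complex.re_add_im, mul_comm]
      rfl
    · simp [e, hj]
  rw [wd_eq_coeff, wd_eq_coeff, he, e.comp_right_fderiv, he', coeff_apply, coeff_apply]
  simp only [ContinuousLinearMap.comp_apply, ContinuousLinearEquiv.coe_coe]
  rw [hv, hv]
  simp only [map_add, map_smul, Complex.real_smul, scaleFactor]
  simp only [mul_one, Complex.mul_I_re, Complex.mul_I_im, Complex.ofReal_neg]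
  linear_combination (-((s (base A)).im * fderiv ℝ u (scale s p) (Pi.single (base A) Complex.I)) / 2
    : ℂ) * (jF_mul_self A) * (-1)

theorem hess_comp_scale {s : Idx dc dt ds → ℂ} (hs : ∀ j, s j ≠ 0) (K : Pt dc dt ds → ℝ)
    (A B : Frame dc dt ds) (p : Pt dc dt ds) :
    hess (fun q => K (scale s q)) p A B =
      scaleFactor s A * scaleFactor s B * hess K (scale s p) A B := by
  have h1 : grad (fun q => K (scale s q)) B = fun q => (scaleFactor s B • grad K B) (scale s q) := by
    funext q
    exact wd_comp_scale hs (fun p => (K p : ℂ)) B q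
  simp only [hess, Matrix.of_apply]
  rw [h1, wd_comp_scale hs, wd_eq_coeff, wd_eq_coeff, fderiv_const_smul_field, Pi.smul_apply,
    map_smul, smul_eq_mul, mul_assoc]

/-! ## Two-forms in an exterior algebra -/

section Exterior

variable {R V ι κ : Type*} [CommRing R] [AddCommGroup V] [Module R V]

theorem ι_mul_ι_comm (a b : V) : ExteriorAlgebra.ι R a * ExteriorAlgebra.ι R b =
    -(ExteriorAlgebra.ι R b * ExteriorAlgebra.ι R a) :=
  eq_neg_of_add_eq_zero_left (ExteriorAlgebra.ι_add_mul_swap a b)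

/-- Moving a one-form past two others costs two signs, which cancel. Two-forms therefore live in a
commutative ring, where finite products and powers are available. -/
theorem ι_mul_ι_mem_center (a b : V) : ExteriorAlgebra.ι R a * ExteriorAlgebra.ι R b ∈
    Subalgebra.center R (ExteriorAlgebra R V) := by
  rw [Subalgebra.mem_center_iff]
  intro x
  induction x using ExteriorAlgebra.induction with
  | algebraMap r => exact Algebra.commutes r _
  | ι m =>
    rw [← mul_assoc, ι_mul_ι_comm m a, neg_mul, mul_assoc, ι_mul_ι_comm m b, mul_neg, neg_neg,
      mul_assoc]
  | mul x y hx hy => rw [mul_assoc, hy, ← mul_assoc, hx, mul_assoc]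
  | add x y hx hy => rw [add_mul, mul_add, hx, hy]

/-- The product of two one-forms, as a central element. -/
noncomputable def wedge (a : V) : V →ₗ[R] Subalgebra.center R (ExteriorAlgebra R V) where
  toFun b := ⟨ExteriorAlgebra.ι R a * ExteriorAlgebra.ι R b, ι_mul_ι_mem_center a b⟩
  map_add' b c := by ext; simp [mul_add]
  map_smul' r b := by ext; simp

theorem coe_wedge (a b : V) : (wedge (R := R) a b : ExteriorAlgebra R V) =
    ExteriorAlgebra.ι R a * ExteriorAlgebra.ι R b := rfl

theorem wedge_mul_wedge_same (a a' b : V) : wedge (R := R) a b * wedge a' b = 0 := by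
  ext
  change ExteriorAlgebra.ι R a * ExteriorAlgebra.ι R b *
    (ExteriorAlgebra.ι R a' * ExteriorAlgebra.ι R b) = 0
  rw [mul_assoc, ← mul_assoc (ExteriorAlgebra.ι R b), ι_mul_ι_comm b a', neg_mul, mul_assoc,
    ExteriorAlgebra.ι_sq_zero]
  simp

theorem wedge_sq (a b : V) : wedge (R := R) a b ^ 2 = 0 := by
  rw [sq, wedge_mul_wedge_same]

theorem add_pow_succ_of_sq_eq_zero {S : Type*} [CommRing S] {x : S} (hx : x ^ 2 = 0) (y : S)
    (m : ℕ) : (x + y) ^ (m + 1) = y ^ (m + 1) + (m + 1) * x * y ^ m := by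
  induction m with
  | zero => simp; ring
  | succ m ih =>
    rw [pow_succ, ih]
    push_cast
    linear_combination ((m : S) + 1) * y ^ m * hx

/-- Only the squarefree monomial survives in the multinomial expansion. The vanishing of the next
power is included because the induction consumes it. -/
theorem sum_pow_of_sq_eq_zero {S : Type*} [CommRing S] (x : ι → S) (hx : ∀ i, x i ^ 2 = 0)
    (s : Finset ι) : (∑ i ∈ s, x i) ^ (s.card + 1) = 0 ∧
      (∑ i ∈ s, x i) ^ s.card = s.card.factorial * ∏ i ∈ s, x i := by
  classical
  induction s using Finset.induction_on with
  | empty => simp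
  | insert a s ha ih =>
    rw [Finset.sum_insert ha, Finset.prod_insert ha, Finset.card_insert_of_notMem ha,
      add_pow_succ_of_sq_eq_zero (hx a), add_pow_succ_of_sq_eq_zero (hx a), pow_succ _ (_ + 1),
      ih.1, ih.2, Nat.factorial_succ]
    constructor
    · simp
    · push_cast; ring

/-! ### Determinants as coefficients of products of two-forms. -/

section Det

variable [Fintype ι] [DecidableEq ι]

/-- The product `∏ a_i ∧ (∑_j v_{ij} b_j)` as an alternating function of the rows of `v`. -/
noncomputable def wedgeRows (a b : ι → V) :
    (ι → R) [⋀^ι]→ₗ[R] Subalgebra.center R (ExteriorAlgebra R V) where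
  __ := (MultilinearMap.mkPiAlgebra R ι (Subalgebra.center R (ExteriorAlgebra R V))).compLinearMap
    fun i => (wedge (a i)).comp (Fintype.linearCombination R b)
  map_eq_zero_of_eq' v i j hv hij := by
    change ∏ k, wedge (a k) (Fintype.linearCombination R b (v k)) = 0
    rw [← Finset.mul_prod_erase _ _ (Finset.mem_univ i), ← Finset.mul_prod_erase _ _
      (Finset.mem_erase.2 ⟨hij.symm, Finset.mem_univ j⟩), hv, ← mul_assoc, wedge_mul_wedge_same,
      zero_mul]

theorem wedgeRows_apply (a b : ι → V) (v : ι → ι → R) :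
    wedgeRows a b v = ∏ i, wedge (R := R) (a i) (∑ j, v i j • b j) := rfl

/-- The left side is alternating in the rows of `M`, hence the determinant times its value at the
identity matrix. -/
theorem prod_wedge_sum (a b : ι → V) (M : Matrix ι ι R) :
    ∏ i, wedge (R := R) (a i) (∑ j, M i j • b j) = M.det • ∏ i, wedge (a i) (b i) := by
  have key : wedgeRows (R := R) a b =
      ((LinearMap.toSpanSingleton R _ (∏ i, wedge (R := R) (a i) (b i))).compAlternatingMap
        Matrix.detRowAlternating) := by
    have hid : wedgeRows (R := R) a b (Pi.basisFun R ι) = ∏ i, wedge (R := R) (a i) (b i) := by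
      rw [wedgeRows_apply]
      simp [Pi.single_apply]
    -- Two alternating maps need only be compared on injective families of basis vectors; here these
    -- are permutations of the basis, and both sides change by the same sign.
    refine Module.Basis.ext_alternating (Pi.basisFun R ι) fun i h => ?_
    let σ : Equiv.Perm ι := Equiv.ofBijective i (Finite.injective_iff_bijective.1 h)
    change wedgeRows (R := R) a b (Pi.basisFun R ι ∘ σ) = (LinearMap.compAlternatingMap _ _)
      (Pi.basisFun R ι ∘ σ)
    rw [AlternatingMap.map_perm, AlternatingMap.map_perm, hid]
    have h1 : Matrix.detRowAlternating (Pi.basisFun R ι) = (1 : R) := by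
      refine Eq.trans (congrArg Matrix.det ?_) Matrix.det_one
      ext i j
      simp [Matrix.one_apply, Pi.single_apply, eq_comm]
    simp [h1]
  exact congrArg (fun f => f M) key

/-- The `N`-th power of a two-form pairing `N` one-forms with `N` other one-forms. -/
theorem sum_ι_mul_ι_pow (a b : ι → V) (M : Matrix ι ι R) :
    (∑ i, ∑ j, M i j • (ExteriorAlgebra.ι R (a i) * ExteriorAlgebra.ι R (b j))) ^ Fintype.card ι =
      ((Fintype.card ι).factorial * M.det : R) •
        ((∏ i, wedge (R := R) (a i) (b i) : Subalgebra.center R (ExteriorAlgebra R V)) :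
          ExteriorAlgebra R V) := by
  have h := (sum_pow_of_sq_eq_zero (fun i => wedge (R := R) (a i) (∑ j, M i j • b j))
    (fun i => wedge_sq _ _) Finset.univ).2
  rw [prod_wedge_sum, Finset.card_univ] at h
  have h2 := congrArg (Subtype.val : Subalgebra.center R (ExteriorAlgebra R V) → _) h
  have h3 : ((∑ i, wedge (R := R) (a i) (∑ j, M i j • b j) :
      Subalgebra.center R (ExteriorAlgebra R V)) : ExteriorAlgebra R V) =
      ∑ i, ∑ j, M i j • (ExteriorAlgebra.ι R (a i) * ExteriorAlgebra.ι R (b j)) := by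
    simp [coe_wedge]
  rw [← h3]
  refine Eq.trans h2 ?_
  rw [mul_smul_comm, mul_comm (Nat.cast _ : R), mul_smul, Nat.cast_smul_eq_nsmul, nsmul_eq_mul]
  rfl

end Det

/-! ### Products of basis elements -/

/-- The product of the one-forms `b k` over a list of labels `k`. -/
noncomputable def listForm (R : Type*) [CommRing R] [Module R V] (b : κ → V) (L : List κ) :
    ExteriorAlgebra R V := (L.map fun k => ExteriorAlgebra.ι R (b k)).prod

theorem listForm_append (b : κ → V) (L L' : List κ) :
    listForm R b (L ++ L') = listForm R b L * listForm R b L' := by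
  simp [listForm]

theorem listForm_cons (b : κ → V) (k : κ) (L : List κ) :
    listForm R b (k :: L) = ExteriorAlgebra.ι R (b k) * listForm R b L := by
  simp [listForm]

theorem listForm_flatMap (b : κ → V) (L : List ι) (F : ι → List κ) :
    listForm R b (L.flatMap F) = (L.map fun i => listForm R b (F i)).prod := by
  induction L with
  | nil => simp [listForm]
  | cons x L ih => rw [List.flatMap_cons, listForm_append, ih]; simp

/-- One-forms anticommute, so a transposition contributes a sign. Its value is left unspecified,
since only its being a unit is ever used. -/
theorem listForm_perm (b : κ → V) {L L' : List κ} (h : L.Perm L') :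
    ∃ s : ℤˣ, listForm R b L = s • listForm R b L' := by
  induction h with
  | nil => exact ⟨1, by simp⟩
  | cons x _ ih =>
    obtain ⟨s, hs⟩ := ih
    exact ⟨s, by rw [listForm_cons, listForm_cons, hs, mul_smul_comm]⟩
  | swap x y L =>
    refine ⟨-1, ?_⟩
    simp only [listForm_cons, ← mul_assoc]
    rw [ι_mul_ι_comm (b y)]
    simp
  | trans _ _ ih ih' =>
    obtain ⟨s, hs⟩ := ih
    obtain ⟨s', hs'⟩ := ih'
    exact ⟨s * s', by rw [hs, hs', mul_smul]⟩

/-- The determinant of the basis extends to a linear functional on the exterior algebra with value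
`1` on this product. -/
theorem listForm_ne_zero [Nontrivial R] [Fintype κ] [DecidableEq κ] (b : Module.Basis κ R V)
    {L : List κ} (hL : L.Nodup) (hmem : ∀ k, k ∈ L) : listForm R b L ≠ 0 := by
  let e := hL.getEquivOfForallMemList L hmem
  let b' := b.reindex e.symm
  intro h0
  have h1 : listForm R b L = ExteriorAlgebra.ιMulti R L.length b' := by
    rw [ExteriorAlgebra.ιMulti_apply, listForm]
    congr 1
    apply List.ext_get
    · simp
    · intro n h1 h2
      simp [b', e]
  -- The functional is defined degree by degree: the determinant in top degree and zero in every
  -- other.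
  have h2 := ExteriorAlgebra.liftAlternating_apply_ιMulti (R := R) (N := R)
    (fun i => if h : i = L.length then h ▸ b'.det else 0) b'
  rw [← h1, h0, map_zero] at h2
  simp [b'.det_self] at h2

end Exterior

/-! ## The Mukai pairing of exponentials -/

theorem degreePart_of_mem {p : ℕ} {x : Forms dc dt ds} (hx : x ∈ ⋀[ℂ]^p (CoT dc dt ds)) (k : ℕ) :
    degreePart k x = if k = p then x else 0 := by
  have h : degreePart k x =
      (DirectSum.decompose (fun i : ℕ => ⋀[ℂ]^i (CoT dc dt ds)) x k : Forms dc dt ds) := rfl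
  rw [h]
  split_ifs with hk
  · subst hk
    exact DirectSum.decompose_of_mem_same _ hx
  · exact DirectSum.decompose_of_mem_ne _ hx (Ne.symm hk)

theorem mukai_of_mem {p q : ℕ} {x y : Forms dc dt ds} (hx : x ∈ ⋀[ℂ]^p (CoT dc dt ds))
    (hy : y ∈ ⋀[ℂ]^q (CoT dc dt ds)) :
    mukai x y = if p + q = realDim dc dt ds then (-1) ^ (p / 2) * (x * y) else 0 := by
  unfold mukai
  simp only [degreePart_of_mem hx, degreePart_of_mem hy]
  split_ifs with h
  · rw [Finset.sum_eq_single p]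
    · rw [if_pos rfl, if_pos (by omega)]
    · intro k _ hk
      simp [hk]
    · intro hp
      exact absurd (Finset.mem_range.2 (by omega)) hp
  · refine Finset.sum_eq_zero fun k hk => ?_
    have := Finset.mem_range.1 hk
    by_cases hkp : k = p
    · rw [if_neg (c := realDim dc dt ds - k = q) (by omega)]
      simp
    · simp [hkp]

theorem degreePart_sum {ι : Type*} (s : Finset ι) (x : ι → Forms dc dt ds) (k : ℕ) :
    degreePart k (∑ i ∈ s, x i) = ∑ i ∈ s, degreePart k (x i) :=
  map_sum (GradedRing.proj (fun i : ℕ => ⋀[ℂ]^i (CoT dc dt ds)) k) x s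

theorem mukai_sum {ι κ : Type*} (s : Finset ι) (t : Finset κ) (x : ι → Forms dc dt ds)
    (y : κ → Forms dc dt ds) :
    mukai (∑ i ∈ s, x i) (∑ j ∈ t, y j) = ∑ i ∈ s, ∑ j ∈ t, mukai (x i) (y j) := by
  unfold mukai
  simp only [degreePart_sum, Finset.sum_mul_sum]
  simp only [Finset.mul_sum]
  rw [Finset.sum_comm]
  refine Finset.sum_congr rfl fun i _ => ?_
  rw [Finset.sum_comm]

/-- On a form of degree `d + 2 i` the Mukai sign is `(-1) ^ (d / 2) * (-1) ^ i`, and the second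
factor replaces `exp ω` by `exp (-ω)`. As `ω` is central, the top-degree part of `exp (-ω) * exp σ`
is given by the binomial theorem. -/
theorem mukai_mul_expForm {d n : ℕ} (hn : 2 * d + 2 * n = realDim dc dt ds)
    {P Q ω σ : Forms dc dt ds} (hP : P ∈ ⋀[ℂ]^d (CoT dc dt ds)) (hQ : Q ∈ ⋀[ℂ]^d (CoT dc dt ds))
    (hω : ω ∈ ⋀[ℂ]^2 (CoT dc dt ds)) (hσ : σ ∈ ⋀[ℂ]^2 (CoT dc dt ds))
    (hωc : ω ∈ Subalgebra.center ℂ (Forms dc dt ds)) :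
    mukai (P * expForm ω) (Q * expForm σ) =
      ((-1) ^ (d / 2) * (n.factorial : ℂ)⁻¹) • (P * Q * (σ - ω) ^ n) := by
  have hdeg {X τ : Forms dc dt ds} (hX : X ∈ ⋀[ℂ]^d (CoT dc dt ds))
      (hτ : τ ∈ ⋀[ℂ]^2 (CoT dc dt ds)) (i : ℕ) :
      X * (((i.factorial : ℂ)⁻¹) • τ ^ i) ∈ ⋀[ℂ]^(d + i * 2) (CoT dc dt ds) :=
    SetLike.mul_mem_graded (A := fun i : ℕ => ⋀[ℂ]^i (CoT dc dt ds)) hX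
      (Submodule.smul_mem _ _ (SetLike.pow_mem_graded (A := fun i : ℕ => ⋀[ℂ]^i (CoT dc dt ds)) i hτ))
  have hcomm (x : Forms dc dt ds) : Commute ω x :=
    ((Subalgebra.mem_center_iff).1 hωc x).symm
  have hterm (i j : ℕ) : mukai (P * (((i.factorial : ℂ)⁻¹) • ω ^ i))
      (Q * (((j.factorial : ℂ)⁻¹) • σ ^ j)) =
      if (i, j) ∈ Finset.HasAntidiagonal.antidiagonal n then ((-1) ^ (d / 2) * ((-1) ^ i *
        ((i.factorial : ℂ)⁻¹ * (j.factorial : ℂ)⁻¹))) • (P * Q * (ω ^ i * σ ^ j)) else 0 := by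
    rw [mukai_of_mem (hdeg hP hω i) (hdeg hQ hσ j)]
    have hiff : (d + i * 2 + (d + j * 2) = realDim dc dt ds) ↔
        (i, j) ∈ Finset.HasAntidiagonal.antidiagonal n := by
      rw [Finset.HasAntidiagonal.mem_antidiagonal]
      omega
    simp only [hiff]
    split_ifs
    · have h1 : (d + i * 2) / 2 = d / 2 + i := by omega
      have h2 : P * ω ^ i * (Q * σ ^ j) = P * Q * (ω ^ i * σ ^ j) := by
        rw [mul_assoc P, ← mul_assoc (ω ^ i), ((hcomm Q).pow_left i).eq]
        simp only [mul_assoc]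
      have h3 (k : ℕ) (x : Forms dc dt ds) : (-1) ^ k * x = ((-1 : ℂ) ^ k) • x := by
        rcases Nat.even_or_odd k with hk | hk <;> simp [hk.neg_one_pow]
      simp only [h1, h3, mul_smul_comm, smul_mul_assoc, h2, smul_smul, pow_add]
      congr 1
      ring
    · rfl
  have hexp : (σ - ω) ^ n = ∑ m ∈ Finset.HasAntidiagonal.antidiagonal n,
      ((n.factorial : ℂ) * ((-1) ^ m.1 * ((m.1.factorial : ℂ)⁻¹ * (m.2.factorial : ℂ)⁻¹))) •
        (ω ^ m.1 * σ ^ m.2) := by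
    rw [sub_eq_neg_add, ((hcomm σ).neg_left).add_pow']
    refine Finset.sum_congr rfl fun m hm => ?_
    have hch : ((n.choose m.1 : ℕ) : ℂ) =
        (n.factorial : ℂ) * ((m.1.factorial : ℂ)⁻¹ * (m.2.factorial : ℂ)⁻¹) := by
      rw [← Finset.HasAntidiagonal.mem_antidiagonal.1 hm, Nat.cast_add_choose, div_eq_mul_inv, mul_inv]
    have hneg : (-ω) ^ m.1 = ((-1 : ℂ) ^ m.1) • ω ^ m.1 := by
      rw [← smul_pow]; simp
    rw [hneg, ← Nat.cast_smul_eq_nsmul ℂ, hch, smul_mul_assoc, smul_smul]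
    congr 1
    ring
  have hf : (n.factorial : ℂ) ≠ 0 := Nat.cast_ne_zero.2 n.factorial_ne_zero
  unfold expForm
  rw [Finset.mul_sum, Finset.mul_sum, mukai_sum]
  simp only [hterm]
  rw [← Finset.sum_product', ← Finset.sum_filter]
  -- The truncation in `expForm` loses nothing: indices with `i + j = n` stay below the cutoff
  -- because `n ≤ D`.
  have hset : (Finset.range (realDim dc dt ds + 1) ×ˢ Finset.range (realDim dc dt ds + 1)).filter
      (fun x => (x.1, x.2) ∈ Finset.HasAntidiagonal.antidiagonal n) = Finset.HasAntidiagonal.antidiagonal n := by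
    ext ⟨i, j⟩
    simp only [Finset.mem_filter, Finset.mem_product, Finset.mem_range, Finset.HasAntidiagonal.mem_antidiagonal]
    omega
  rw [hset, hexp, Finset.mul_sum, Finset.smul_sum]
  refine Finset.sum_congr rfl fun m _ => ?_
  rw [mul_smul_comm, smul_smul]
  congr 1
  field_simp

/-! ## Conjugation of the forms built from the potential -/

theorem conjForm_one : conjForm (1 : Forms dc dt ds) = 1 := map_one conjHom

theorem conjForm_pow (x : Forms dc dt ds) (k : ℕ) : conjForm (x ^ k) = conjForm x ^ k :=
  map_pow conjHom x k

theorem conjForm_neg (x : Forms dc dt ds) : conjForm (-x) = -conjForm x := map_neg conjHom x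

theorem conjForm_sum {ι : Type*} (s : Finset ι) (x : ι → Forms dc dt ds) :
    conjForm (∑ i ∈ s, x i) = ∑ i ∈ s, conjForm (x i) :=
  map_sum (conjHom (dc := dc) (dt := dt) (ds := ds)) x s

theorem conjForm_expForm (ω : Forms dc dt ds) : conjForm (expForm ω) = expForm (conjForm ω) := by
  unfold expForm
  rw [conjForm_sum]
  refine Finset.sum_congr rfl fun k _ => ?_
  rw [conjForm_smul, conjForm_pow]
  simp

theorem conjForm_listForm (L : List (Frame dc dt ds)) :
    conjForm (listForm ℂ dz L) = listForm ℂ dz (L.map bar) := by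
  induction L with
  | nil => simpa [listForm] using conjForm_one
  | cons A L ih => rw [List.map_cons, listForm_cons, listForm_cons, conjForm_mul, ih,
      conjForm_one_form, conjCoT_dz]

theorem listForm_mem (L : List (Frame dc dt ds)) :
    listForm ℂ dz L ∈ ⋀[ℂ]^L.length (CoT dc dt ds) := by
  have h := SetLike.list_prod_map_mem_graded (A := fun i : ℕ => ⋀[ℂ]^i (CoT dc dt ds)) L
    (fun _ => 1) (fun A => ExteriorAlgebra.ι ℂ (dz A)) fun A _ => by
      change _ ∈ LinearMap.range _ ^ 1
      rw [pow_one]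
      exact LinearMap.mem_range_self _ _
  simpa [listForm] using h

theorem ι_mul_ι_mem (m n : CoT dc dt ds) :
    ExteriorAlgebra.ι ℂ m * ExteriorAlgebra.ι ℂ n ∈ ⋀[ℂ]^2 (CoT dc dt ds) := by
  change _ ∈ LinearMap.range _ ^ 2
  rw [pow_two]
  exact Submodule.mul_mem_mul (LinearMap.mem_range_self _ _) (LinearMap.mem_range_self _ _)

theorem dForm_mem (K : Pt dc dt ds → ℝ) (w : Frame dc dt ds → ℂ) (p : Pt dc dt ds) :
    dForm K w p ∈ ⋀[ℂ]^2 (CoT dc dt ds) :=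
  Submodule.sum_mem _ fun _ _ => Submodule.smul_mem _ _ (ι_mul_ι_mem _ _)

theorem dForm_mem_center (K : Pt dc dt ds → ℝ) (w : Frame dc dt ds → ℂ) (p : Pt dc dt ds) :
    dForm K w p ∈ Subalgebra.center ℂ (Forms dc dt ds) :=
  Subalgebra.sum_mem _ fun _ _ => Subalgebra.smul_mem _ (ι_mul_ι_mem_center _ _) _

theorem dForm_eq (K : Pt dc dt ds → ℝ) (w : Frame dc dt ds → ℂ) (p : Pt dc dt ds) :
    dForm K w p = ∑ A, ∑ B, (w A * hess K p B A) •
      (ExteriorAlgebra.ι ℂ (dz B) * ExteriorAlgebra.ι ℂ (dz A)) := by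
  unfold dForm
  refine Finset.sum_congr rfl fun A _ => ?_
  rw [fderiv_grad_eq_sum, map_sum, Finset.sum_mul, Finset.smul_sum]
  refine Finset.sum_congr rfl fun B _ => ?_
  rw [map_smul, smul_mul_assoc, smul_smul]

/-- The hypothesis `hw` says that the one-form being differentiated is real, the potential being
real. -/
theorem conjForm_dForm {K : Pt dc dt ds → ℝ} {w : Frame dc dt ds → ℂ} {p : Pt dc dt ds}
    (hK : ContDiffAt ℝ 2 K p) (hw : ∀ A, (starRingEnd ℂ) (w A) = w (bar A)) :
    conjForm (dForm K w p) = dForm K w p := by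
  rw [dForm_eq, conjForm_sum]
  refine Fintype.sum_equiv bar _ _ fun A => ?_
  rw [conjForm_sum]
  refine Fintype.sum_equiv bar _ _ fun B => ?_
  rw [conjForm_smul, conjForm_mul, conjForm_one_form, conjForm_one_form, conjCoT_dz, conjCoT_dz,
    map_mul, hw, conj_hess hK]

/-! ## The coordinate volume form -/

theorem ι_dx_mul_ι_dy (A : Frame dc dt ds) :
    ExteriorAlgebra.ι ℂ (dx A) * ExteriorAlgebra.ι ℂ (dy A) =
      (Complex.I / 2) • (ExteriorAlgebra.ι ℂ (dz A) * ExteriorAlgebra.ι ℂ (dz (bar A))) := by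
  have h1 : dx A = (1 / 2 : ℂ) • (dz A + dz (bar A)) := by
    ext v
    have h : dx A v = ((dz A v).re : ℂ) := rfl
    rw [h]
    simp only [smul_apply, add_apply, ← conj_dz, Complex.add_conj]
    simp
  have h2 : dy A = (-Complex.I / 2 : ℂ) • (dz A - dz (bar A)) := by
    ext v
    have h : dy A v = ((dz A v).im : ℂ) := rfl
    rw [h]
    simp only [smul_apply, sub_apply, ← conj_dz, Complex.sub_conj, smul_eq_mul]
    push_cast
    linear_combination ((dz A v).im : ℂ) * Complex.I_sq
  rw [h1, h2, map_smul, map_smul, map_add, map_sub, smul_mul_smul_comm, add_mul, mul_sub, mul_sub,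
    ExteriorAlgebra.ι_sq_zero, ExteriorAlgebra.ι_sq_zero, ι_mul_ι_comm (dz (bar A)), zero_sub,
    sub_zero, ← neg_add, ← two_smul ℂ (_ * _), smul_neg, smul_smul, ← neg_smul]
  congr 1
  ring

theorem areaProd_eq {n : ℕ} (e : Fin n → Frame dc dt ds) :
    areaProd e = ((Complex.I / 2) ^ n) •
      listForm ℂ dz ((List.finRange n).flatMap fun i => [e i, bar (e i)]) := by
  have h (L : List (Fin n)) : (L.map fun i => ExteriorAlgebra.ι ℂ (dx (e i)) *
      ExteriorAlgebra.ι ℂ (dy (e i))).prod =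
      ((Complex.I / 2) ^ L.length) • listForm ℂ dz (L.flatMap fun i => [e i, bar (e i)]) := by
    rw [listForm_flatMap]
    induction L with
    | nil => simp
    | cons i L ih =>
      rw [List.map_cons, List.prod_cons, ih, ι_dx_mul_ι_dy, List.map_cons, List.prod_cons,
        smul_mul_smul_comm, List.length_cons, pow_succ']
      simp [listForm]
  rw [areaProd, h, List.length_finRange]

theorem nodup_of_card_le {α : Type*} [Fintype α] [DecidableEq α] {L : List α}
    (hmem : ∀ a, a ∈ L) (hlen : L.length ≤ Fintype.card α) : L.Nodup := by
  have h : L.toFinset = Finset.univ := Finset.eq_univ_of_forall fun a => List.mem_toFinset.2 (hmem a)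
  have h1 : (L : Multiset α).toFinset.card = (L : Multiset α).card := by
    refine le_antisymm (Multiset.toFinset_card_le _) ?_
    rw [List.toFinset_coe, h, Finset.card_univ]
    simpa using hlen
  simpa using Multiset.toFinset_card_eq_card_iff_nodup.1 h1

theorem card_frame : Fintype.card (Frame dc dt ds) = realDim dc dt ds := by
  simp [realDim]; ring

/-- Up to a power of `i / 2`, the volume form is itself a product of all the `dz A`, and any two
orderings differ by a sign. The constant depends on the list alone. -/
theorem listForm_eq_smul_coordVol {L : List (Frame dc dt ds)} (hmem : ∀ A, A ∈ L)
    (hlen : L.length = realDim dc dt ds) :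
    ∃ a : ℂ, a ≠ 0 ∧ listForm ℂ dz L = a • coordVol dc dt ds := by
  let pairs {n : ℕ} (e : Fin n → Frame dc dt ds) : List (Frame dc dt ds) :=
    (List.finRange n).flatMap fun i => [e i, bar (e i)]
  have hlenp {n : ℕ} (e : Fin n → Frame dc dt ds) : (pairs e).length = 2 * n := by
    simp [pairs, mul_comm]
  have hV : coordVol dc dt ds = ((Complex.I / 2) ^ ds * (Complex.I / 2) ^ ds *
      (Complex.I / 2) ^ dc * (Complex.I / 2) ^ dt) •
        listForm ℂ dz (pairs l ++ pairs r ++ pairs c ++ pairs t) := by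
    rw [coordVol, areaProd_eq, areaProd_eq, areaProd_eq, areaProd_eq, smul_mul_smul_comm,
      smul_mul_smul_comm, smul_mul_smul_comm, listForm_append, listForm_append, listForm_append]
  have hmem' : ∀ A, A ∈ pairs l ++ pairs r ++ pairs c ++ pairs t := by
    rintro (((i | i) | (i | i)) | ((i | i) | (i | i))) <;>
      simp [pairs, l, r, c, t, fL, fR, fC, fT, bar]
  have hlen' : (pairs l ++ pairs r ++ pairs c ++ pairs t : List (Frame dc dt ds)).length =
      realDim dc dt ds := by
    simp only [List.length_append, hlenp, realDim]
    ring
  have hnd := nodup_of_card_le hmem (by rw [hlen, card_frame])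
  have hnd' := nodup_of_card_le hmem' (by rw [hlen', card_frame])
  obtain ⟨s, hs⟩ := listForm_perm (R := ℂ) dz
    ((List.perm_ext_iff_of_nodup hnd hnd').2 fun A => by simp only [hmem, hmem'])
  have hI : Complex.I / 2 ≠ 0 := by simp
  set w : ℂ := (Complex.I / 2) ^ ds * (Complex.I / 2) ^ ds *
      (Complex.I / 2) ^ dc * (Complex.I / 2) ^ dt with hw
  have hw0 : w ≠ 0 := by simp [hw]
  refine ⟨((s : ℤ) : ℂ) * w⁻¹, mul_ne_zero (by simp) (inv_ne_zero hw0), ?_⟩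
  rw [hV, smul_smul, mul_assoc, inv_mul_cancel₀ hw0, mul_one, hs]
  rw [Units.smul_def, Int.cast_smul_eq_zsmul]

theorem coordVol_ne_zero : coordVol dc dt ds ≠ 0 := by
  classical
  intro h
  have hmem : ∀ A, A ∈ (Finset.univ : Finset (Frame dc dt ds)).toList := by simp
  have hlen : (Finset.univ : Finset (Frame dc dt ds)).toList.length = realDim dc dt ds := by
    rw [Finset.length_toList, Finset.card_univ, card_frame]
  obtain ⟨a, -, ha⟩ := listForm_eq_smul_coordVol hmem hlen
  have hne := listForm_ne_zero (R := ℂ) dzBasis (Finset.nodup_toList Finset.univ) hmem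
  rw [h, smul_zero] at ha
  exact hne (by simpa [listForm] using ha)

/-! ## The pairing of a spinor with its conjugate -/

section Pairing

variable {d : ℕ} {ι : Type*} [Fintype ι]

/-- Multiplication by all `dz^e` and their conjugates kills every term with such a leg. Among the
remaining labels, pairs of equal weight cancel, since `K_{AB}` is symmetric and the wedge
antisymmetric; a mixed pair occurs in two orders and contributes `y - (-y) = 2 y`. -/
theorem listForm_mul_dForm {K : Pt dc dt ds → ℝ} {p : Pt dc dt ds} (hK : ContDiffAt ℝ 2 K p)
    {e : Fin d → Frame dc dt ds} {a b : ι → Frame dc dt ds}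
    (hE : Function.Bijective (Sum.elim (Sum.elim e (bar ∘ e)) (Sum.elim a b)))
    {w : Frame dc dt ds → ℂ} {y : ℂ} (ha : ∀ i, w (a i) = -y) (hb : ∀ i, w (b i) = y) :
    listForm ℂ dz ((List.finRange d).map e ++ ((List.finRange d).map e).map bar) * dForm K w p =
      listForm ℂ dz ((List.finRange d).map e ++ ((List.finRange d).map e).map bar) *
        ((2 * y) • ∑ i, ∑ j, (hess K p).submatrix a b i j •
          (ExteriorAlgebra.ι ℂ (dz (a i)) * ExteriorAlgebra.ι ℂ (dz (b j)))) := by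
  classical
  set L := (List.finRange d).map e ++ ((List.finRange d).map e).map bar with hL
  have hkill {A : Frame dc dt ds} (hA : A ∈ L) :
      listForm ℂ dz L * ExteriorAlgebra.ι ℂ (dz A) = 0 := by
    -- The factor `dz A` is moved to the end of the product, where it meets a second copy of itself.
    obtain ⟨L', hL'⟩ : ∃ L', L.Perm (L' ++ [A]) :=
      let ⟨s, t, h⟩ := List.append_of_mem hA
      ⟨s ++ t, h ▸ List.perm_middle.trans (List.perm_append_singleton _ _).symm⟩
    obtain ⟨s, hs⟩ := listForm_perm (R := ℂ) dz hL'
    rw [hs, listForm_append, smul_mul_assoc, mul_assoc]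
    simp [listForm]
  have hkill₁ {A : Frame dc dt ds} (hA : A ∈ L) (B : Frame dc dt ds) (x : ℂ) :
      listForm ℂ dz L * (x • (ExteriorAlgebra.ι ℂ (dz A) * ExteriorAlgebra.ι ℂ (dz B))) = 0 := by
    rw [mul_smul_comm, ← mul_assoc, hkill hA, zero_mul, smul_zero]
  have hkill₂ {A : Frame dc dt ds} (hA : A ∈ L) (B : Frame dc dt ds) (x : ℂ) :
      listForm ℂ dz L * (x • (ExteriorAlgebra.ι ℂ (dz B) * ExteriorAlgebra.ι ℂ (dz A))) = 0 := by
    rw [ι_mul_ι_comm, smul_neg, mul_neg, hkill₁ hA, neg_zero]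
  have he (i : Fin d) : e i ∈ L := by simp [hL]
  have he' (i : Fin d) : bar (e i) ∈ L := by simp [hL]
  have hsum {M : Type _} [AddCommMonoid M] (F : Frame dc dt ds → M) : ∑ A, F A =
      ∑ i, F (e i) + ∑ i, F (bar (e i)) + (∑ i, F (a i) + ∑ i, F (b i)) := by
    rw [← (Equiv.ofBijective _ hE).sum_comp]
    simp [Fintype.sum_sum_type]
  -- Exchanging the two summation indices changes the sum into its negative.
  have hanti (f : ι → Frame dc dt ds) (x : ℂ) : ∑ i, ∑ j, (x * hess K p (f j) (f i)) •
      (ExteriorAlgebra.ι ℂ (dz (f j)) * ExteriorAlgebra.ι ℂ (dz (f i))) = 0 := by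
    have h : ∑ i, ∑ j, (x * hess K p (f j) (f i)) •
        (ExteriorAlgebra.ι ℂ (dz (f j)) * ExteriorAlgebra.ι ℂ (dz (f i))) =
        -∑ i, ∑ j, (x * hess K p (f j) (f i)) •
        (ExteriorAlgebra.ι ℂ (dz (f j)) * ExteriorAlgebra.ι ℂ (dz (f i))) := by
      conv_lhs => rw [Finset.sum_comm]
      rw [← Finset.sum_neg_distrib]
      refine Finset.sum_congr rfl fun i _ => ?_
      rw [← Finset.sum_neg_distrib]
      refine Finset.sum_congr rfl fun j _ => ?_
      rw [hess_symm hK, ι_mul_ι_comm, smul_neg]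
    have h2 (x : Forms dc dt ds) (hx : x = -x) : x = 0 := by
      have h3 : (2 : ℂ) • x = 0 := by rw [two_smul]; nth_rewrite 1 [hx]; simp
      rw [← one_smul ℂ x, ← inv_mul_cancel₀ (two_ne_zero (α := ℂ)), mul_smul, h3, smul_zero]
    exact h2 _ h
  rw [dForm_eq, Finset.mul_sum, hsum]
  have z1 {A : Frame dc dt ds} (hA : A ∈ L) : listForm ℂ dz L * ∑ B, (w A * hess K p B A) •
      (ExteriorAlgebra.ι ℂ (dz B) * ExteriorAlgebra.ι ℂ (dz A)) = 0 := by
    rw [Finset.mul_sum]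
    exact Finset.sum_eq_zero fun B _ => hkill₂ hA B _
  have z2 (A : Frame dc dt ds) : listForm ℂ dz L * ∑ B, (w A * hess K p B A) •
      (ExteriorAlgebra.ι ℂ (dz B) * ExteriorAlgebra.ι ℂ (dz A)) =
      listForm ℂ dz L * (∑ i, (w A * hess K p (a i) A) •
        (ExteriorAlgebra.ι ℂ (dz (a i)) * ExteriorAlgebra.ι ℂ (dz A)) +
        ∑ i, (w A * hess K p (b i) A) •
        (ExteriorAlgebra.ι ℂ (dz (b i)) * ExteriorAlgebra.ι ℂ (dz A))) := by
    rw [Finset.mul_sum, hsum, mul_add, Finset.mul_sum, Finset.mul_sum,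
      Finset.sum_eq_zero fun i _ => hkill₁ (he i) A _,
      Finset.sum_eq_zero fun i _ => hkill₁ (he' i) A _, add_zero, zero_add]
  rw [Finset.sum_eq_zero fun i _ => z1 (he i), Finset.sum_eq_zero fun i _ => z1 (he' i), add_zero,
    zero_add]
  rw [Finset.sum_congr rfl fun i _ => z2 (a i), Finset.sum_congr rfl fun i _ => z2 (b i)]
  rw [← Finset.mul_sum, ← Finset.mul_sum, ← mul_add, Finset.sum_add_distrib, Finset.sum_add_distrib]
  simp only [ha, hb]
  rw [hanti a, hanti b, zero_add, add_zero]
  congr 1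
  rw [two_mul, add_smul]
  congr 1
  · simp only [Finset.smul_sum]
    refine Finset.sum_congr rfl fun i _ => Finset.sum_congr rfl fun j _ => ?_
    rw [hess_symm hK, ι_mul_ι_comm, smul_neg, smul_smul, Matrix.submatrix_apply, neg_mul, neg_smul,
      neg_neg]
  · rw [Finset.sum_comm]
    simp only [Finset.smul_sum, smul_smul, Matrix.submatrix_apply]

/-- Centrality of `S` lets each factor in turn be brought next to `X` and replaced by `T`. -/
theorem mul_pow_eq_mul_pow {X S T : Forms dc dt ds}
    (hS : S ∈ Subalgebra.center ℂ (Forms dc dt ds)) (h : X * S = X * T) (n : ℕ) :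
    X * S ^ n = X * T ^ n := by
  induction n with
  | zero => simp
  | succ n ih =>
    rw [pow_succ, ← mul_assoc, ih, mul_assoc, (Subalgebra.mem_center_iff.1 hS), ← mul_assoc, h,
      mul_assoc, pow_succ']

theorem coe_prod_wedge (a b : ι → Frame dc dt ds) :
    ((∏ i, wedge (R := ℂ) (dz (a i)) (dz (b i)) :
      Subalgebra.center ℂ (Forms dc dt ds)) : Forms dc dt ds) =
      listForm ℂ dz ((Finset.univ : Finset ι).toList.flatMap fun i => [a i, b i]) := by
  rw [listForm_flatMap, ← Finset.prod_map_toList]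
  have h := map_list_prod (Subalgebra.center ℂ (Forms dc dt ds)).val
    ((Finset.univ : Finset ι).toList.map fun i => wedge (R := ℂ) (dz (a i)) (dz (b i)))
  refine Eq.trans h ?_
  rw [List.map_map]
  congr 2
  funext i
  simp [listForm, coe_wedge]

variable [DecidableEq ι]

/-- The Mukai pairing of a pure spinor `dz^{e_1} ∧ … ∧ dz^{e_d} ∧ e^{R + iS}` with its conjugate,
when `S` pairs the labels `a` with the labels `b` up to multiples of the `dz^e` and `dz̄^e`. -/
theorem mukai_spinor {e : Fin d → Frame dc dt ds} {a b : ι → Frame dc dt ds}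
    (hE : Function.Bijective (Sum.elim (Sum.elim e (bar ∘ e)) (Sum.elim a b)))
    {z : ℂ} (hz : z ≠ 0) :
    ∃ C : ℂ, C ≠ 0 ∧ ∀ (R S : Forms dc dt ds) (M : Matrix ι ι ℂ),
      R ∈ ⋀[ℂ]^2 (CoT dc dt ds) → S ∈ ⋀[ℂ]^2 (CoT dc dt ds) →
      R ∈ Subalgebra.center ℂ (Forms dc dt ds) → S ∈ Subalgebra.center ℂ (Forms dc dt ds) →
      conjForm R = R → conjForm S = S →
      listForm ℂ dz ((List.finRange d).map e ++ ((List.finRange d).map e).map bar) * S =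
        listForm ℂ dz ((List.finRange d).map e ++ ((List.finRange d).map e).map bar) *
        (z • ∑ i, ∑ j, M i j • (ExteriorAlgebra.ι ℂ (dz (a i)) * ExteriorAlgebra.ι ℂ (dz (b j)))) →
      mukai (listForm ℂ dz ((List.finRange d).map e) * expForm (R + Complex.I • S))
        (conjForm (listForm ℂ dz ((List.finRange d).map e) * expForm (R + Complex.I • S))) =
        (C * M.det) • coordVol dc dt ds := by
  set L := (List.finRange d).map e ++ ((List.finRange d).map e).map bar with hL
  set L' := (Finset.univ : Finset ι).toList.flatMap fun i => [a i, b i] with hL'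
  have hcard : 2 * d + 2 * Fintype.card ι = realDim dc dt ds := by
    rw [← card_frame, ← Fintype.card_of_bijective hE]
    simp
    ring
  have hmem : ∀ A, A ∈ L ++ L' := by
    intro A
    obtain ⟨((i | i) | (i | i)), rfl⟩ := hE.2 A
    · simp [hL]
    · simp [hL]
    · exact List.mem_append_right _ (List.mem_flatMap.2 ⟨i, by simp, by simp⟩)
    · exact List.mem_append_right _ (List.mem_flatMap.2 ⟨i, by simp, by simp⟩)
  have hlen : (L ++ L').length = realDim dc dt ds := by
    rw [← hcard]
    simp [hL, hL']
    ring
  obtain ⟨C₀, hC₀, hvol⟩ := listForm_eq_smul_coordVol hmem hlen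
  set n := Fintype.card ι with hn
  -- The first two factors come from `mukai_mul_expForm`; `(-2 i)^n`, `z^n` and `n!` come from the
  -- `n`-th power of `-2 i S`; `C₀` converts the product of all `dz` into the volume form. None of
  -- them involves `R`, `S` or `M`.
  refine ⟨(-1) ^ (d / 2) * (n.factorial : ℂ)⁻¹ * ((-2 * Complex.I) ^ n * z ^ n * n.factorial) * C₀,
    ?_, ?_⟩
  · have : (n.factorial : ℂ) ≠ 0 := Nat.cast_ne_zero.2 n.factorial_ne_zero
    simp [hz, hC₀, this]
  intro R S M hR hS hRc hSc hRr hSr hM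
  have hconj : conjForm (listForm ℂ dz ((List.finRange d).map e) * expForm (R + Complex.I • S)) =
      listForm ℂ dz (((List.finRange d).map e).map bar) * expForm (R - Complex.I • S) := by
    rw [conjForm_mul, conjForm_listForm, conjForm_expForm, conjForm_add, conjForm_smul, hRr, hSr,
      Complex.conj_I, neg_smul, sub_eq_add_neg]
  have hP := listForm_mem ((List.finRange d).map e)
  have hQ := listForm_mem (((List.finRange d).map e).map bar)
  rw [List.length_map, List.length_finRange] at hP
  rw [List.length_map, List.length_map, List.length_finRange] at hQ
  -- Here `R` drops out of the pairing.
  have hsub : R - Complex.I • S - (R + Complex.I • S) = (-2 * Complex.I) • S := by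
    rw [mul_smul, neg_smul, two_smul]
    abel
  rw [hconj, mukai_mul_expForm hcard hP hQ (Submodule.add_mem _ hR (Submodule.smul_mem _ _ hS))
    (Submodule.sub_mem _ hR (Submodule.smul_mem _ _ hS))
    (Subalgebra.add_mem _ hRc (Subalgebra.smul_mem _ hSc _)), hsub, smul_pow, mul_smul_comm,
    ← listForm_append, ← hL, mul_pow_eq_mul_pow hSc hM, smul_pow, mul_smul_comm,
    sum_ι_mul_ι_pow, mul_smul_comm, coe_prod_wedge, ← hL', ← listForm_append, hvol]
  simp only [smul_smul]
  congr 1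
  ring

end Pairing

/-! ## The pairings of the two pure spinors -/

/-- The matrix on the left-hand side of the generalized Monge-Ampère equation. -/
noncomputable def leftMatrix (K : Pt dc dt ds → ℝ) (p : Pt dc dt ds) :
    Matrix (Fin ds ⊕ (Fin ds ⊕ Fin dt)) (Fin ds ⊕ (Fin ds ⊕ Fin dt)) ℂ :=
  (hess K p).submatrix (Sum.elim l (Sum.elim rb t)) (Sum.elim lb (Sum.elim r tb))

/-- The matrix on the right-hand side of the generalized Monge-Ampère equation. -/
noncomputable def rightMatrix (K : Pt dc dt ds → ℝ) (p : Pt dc dt ds) :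
    Matrix (Fin ds ⊕ (Fin ds ⊕ Fin dc)) (Fin ds ⊕ (Fin ds ⊕ Fin dc)) ℂ :=
  (hess K p).submatrix (Sum.elim l (Sum.elim r c)) (Sum.elim rb (Sum.elim lb cb))

theorem conj_weight (x y z w : ℝ) (A : Frame dc dt ds) :
    (starRingEnd ℂ) (weight x y z w A) = weight x y z w (bar A) := by
  rcases A with ((_ | _) | (_ | _)) | ((_ | _) | (_ | _)) <;> simp [weight, bar]

theorem bijective_of_surjective {d : ℕ} {ι : Type*} [Fintype ι] {e : Fin d → Frame dc dt ds}
    {a b : ι → Frame dc dt ds} (hd : d + Fintype.card ι = dc + dt + 2 * ds)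
    (h : Function.Surjective (Sum.elim (Sum.elim e (bar ∘ e)) (Sum.elim a b))) :
    Function.Bijective (Sum.elim (Sum.elim e (bar ∘ e)) (Sum.elim a b)) := by
  refine (Fintype.bijective_iff_surjective_and_card _).2 ⟨h, ?_⟩
  rw [card_frame, realDim]
  simp
  omega

/-- In `S₁` the weight is `J` on `L` and `T`, `-J` on `R` and zero on `C`. The value `i` is thus
taken on `l, r̄, t` and `-i` on `l̄, r, t̄`, which are the rows and columns of `leftMatrix`; the `C`
labels are killed by the chiral prefactor and its conjugate. -/
theorem mukai_spinor₁ : ∃ C : ℂ, C ≠ 0 ∧ ∀ (K : Pt dc dt ds → ℝ) (p : Pt dc dt ds),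
    ContDiffAt ℝ 2 K p → mukai (spinor₁ 0 K p) (conjForm (spinor₁ 0 K p)) =
      (C * (leftMatrix K p).det) • coordVol dc dt ds := by
  have hE : Function.Bijective (Sum.elim (Sum.elim (c (dc := dc) (dt := dt) (ds := ds)) (bar ∘ c))
      (Sum.elim (Sum.elim l (Sum.elim rb t)) (Sum.elim lb (Sum.elim r tb)))) := by
    refine bijective_of_surjective (by simp; ring) ?_
    rintro (((i | i) | (i | i)) | ((i | i) | (i | i)))
    · exact ⟨.inr (.inl (.inl i)), rfl⟩
    · exact ⟨.inr (.inr (.inl i)), rfl⟩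
    · exact ⟨.inr (.inr (.inr (.inl i))), rfl⟩
    · exact ⟨.inr (.inl (.inr (.inl i))), rfl⟩
    · exact ⟨.inl (.inl i), rfl⟩
    · exact ⟨.inl (.inr i), rfl⟩
    · exact ⟨.inr (.inl (.inr (.inr i))), rfl⟩
    · exact ⟨.inr (.inr (.inr (.inr i))), rfl⟩
  obtain ⟨C, hC, h⟩ := mukai_spinor hE (z := 2 * -Complex.I) (by simp)
  refine ⟨C, hC, fun K p hK => ?_⟩
  have hw₁ : ∀ A : Frame dc dt ds, (starRingEnd ℂ) (weight 1 0 0 0 A) = weight 1 0 0 0 (bar A) := by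
    simpa using conj_weight 1 0 0 0
  have hw₂ : ∀ A : Frame dc dt ds, (starRingEnd ℂ) (jF A * weight 1 (-1) 0 1 A) =
      jF (bar A) * weight 1 (-1) 0 1 (bar A) := by
    intro A
    have := conj_weight 1 (-1) 0 1 A
    push_cast at this
    simp [this]
  have hS := listForm_mul_dForm hK hE (w := jF * weight 1 (-1) 0 1) (y := -Complex.I)
    (by rintro (i | i | i) <;> simp [l, rb, t, fL, fR, fT, jF, jD, weight])
    (by rintro (i | i | i) <;> simp [lb, r, tb, fL, fR, fT, jF, jD, weight])
  have := h (-dForm K (weight 1 0 0 0) p) (dForm K (jF * weight 1 (-1) 0 1) p) (leftMatrix K p)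
    (Submodule.neg_mem _ (dForm_mem _ _ _)) (dForm_mem _ _ _)
    (Subalgebra.neg_mem _ (dForm_mem_center _ _ _)) (dForm_mem_center _ _ _)
    (by rw [conjForm_neg, conjForm_dForm hK hw₁]) (conjForm_dForm (w := jF * weight 1 (-1) 0 1) hK hw₂) hS
  rw [← this]
  have hs : spinor₁ 0 K p = listForm ℂ dz ((List.finRange dc).map c) *
      expForm (-dForm K (weight 1 0 0 0) p + Complex.I • dForm K (jF * weight 1 (-1) 0 1) p) := by
    simp only [spinor₁, Pi.zero_apply, Complex.exp_zero, one_smul, listForm, List.map_map]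
    rfl
  rw [hs]

/-- In `S₂` the groups `L`, `R`, `C` all carry the weight `J` up to an overall sign, so unbarred
labels pair with barred ones. The overall minus sign is put into `z`. -/
theorem mukai_spinor₂ : ∃ C : ℂ, C ≠ 0 ∧ ∀ (K : Pt dc dt ds → ℝ) (p : Pt dc dt ds),
    ContDiffAt ℝ 2 K p → mukai (spinor₂ 0 K p) (conjForm (spinor₂ 0 K p)) =
      (C * (rightMatrix K p).det) • coordVol dc dt ds := by
  have hE : Function.Bijective (Sum.elim (Sum.elim (t (dc := dc) (dt := dt) (ds := ds)) (bar ∘ t))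
      (Sum.elim (Sum.elim l (Sum.elim r c)) (Sum.elim rb (Sum.elim lb cb)))) := by
    refine bijective_of_surjective (by simp; ring) ?_
    rintro (((i | i) | (i | i)) | ((i | i) | (i | i)))
    · exact ⟨.inr (.inl (.inl i)), rfl⟩
    · exact ⟨.inr (.inr (.inr (.inl i))), rfl⟩
    · exact ⟨.inr (.inl (.inr (.inl i))), rfl⟩
    · exact ⟨.inr (.inr (.inl i)), rfl⟩
    · exact ⟨.inr (.inl (.inr (.inr i))), rfl⟩
    · exact ⟨.inr (.inr (.inr (.inr i))), rfl⟩
    · exact ⟨.inl (.inl i), rfl⟩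
    · exact ⟨.inl (.inr i), rfl⟩
  obtain ⟨C, hC, h⟩ := mukai_spinor hE (z := -(2 * -Complex.I)) (by simp)
  refine ⟨C, hC, fun K p hK => ?_⟩
  have hw₁ : ∀ A : Frame dc dt ds, (starRingEnd ℂ) (weight 0 1 0 0 A) = weight 0 1 0 0 (bar A) := by
    simpa using conj_weight 0 1 0 0
  have hw₂ : ∀ A : Frame dc dt ds, (starRingEnd ℂ) (jF A * weight 1 1 1 0 A) =
      jF (bar A) * weight 1 1 1 0 (bar A) := by
    intro A
    have := conj_weight 1 1 1 0 A
    push_cast at this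
    simp [this]
  have hS := listForm_mul_dForm hK hE (w := jF * weight 1 1 1 0) (y := -Complex.I)
    (by rintro (i | i | i) <;> simp [l, r, c, fL, fR, fC, jF, jD, weight])
    (by rintro (i | i | i) <;> simp [lb, rb, cb, fL, fR, fC, jF, jD, weight])
  have := h (-dForm K (weight 0 1 0 0) p) (-dForm K (jF * weight 1 1 1 0) p) (rightMatrix K p)
    (Submodule.neg_mem _ (dForm_mem _ _ _)) (Submodule.neg_mem _ (dForm_mem _ _ _))
    (Subalgebra.neg_mem _ (dForm_mem_center _ _ _)) (Subalgebra.neg_mem _ (dForm_mem_center _ _ _))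
    (by rw [conjForm_neg, conjForm_dForm hK hw₁]) (by rw [conjForm_neg, conjForm_dForm (w := jF * weight 1 1 1 0) hK hw₂])
    (by rw [mul_neg (listForm _ _ _), hS, neg_smul, mul_neg (listForm _ _ _), rightMatrix])
  rw [← this]
  have hs : spinor₂ 0 K p = listForm ℂ dz ((List.finRange dt).map t) *
      expForm (-dForm K (weight 0 1 0 0) p + Complex.I • -dForm K (jF * weight 1 1 1 0) p) := by
    simp only [spinor₂, Pi.zero_apply, Complex.exp_zero, one_smul, listForm, List.map_map]
    rfl
  rw [hs]

open Matrix

/-! ## Reality of the metric -/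

/-- Complex conjugation of the entries permutes the labels by `σ` and `τ`. -/
def ConjEquivariant {m n : Type*} (σ : m ≃ m) (τ : n ≃ n) (M : Matrix m n ℂ) : Prop :=
  ∀ a b, (starRingEnd ℂ) (M a b) = M (σ a) (τ b)

namespace ConjEquivariant

variable {m n k : Type*} {σ : m ≃ m} {τ : n ≃ n} {ρ : k ≃ k}

theorem mul [Fintype n] {M : Matrix m n ℂ} {N : Matrix n k ℂ} (hM : ConjEquivariant σ τ M)
    (hN : ConjEquivariant τ ρ N) : ConjEquivariant σ ρ (M * N) := by
  intro a b
  rw [mul_apply, mul_apply, map_sum]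
  exact Fintype.sum_equiv τ _ _ fun i => by rw [map_mul, hM, hN]

theorem sub {M N : Matrix m n ℂ} (hM : ConjEquivariant σ τ M) (hN : ConjEquivariant σ τ N) :
    ConjEquivariant σ τ (M - N) := fun a b => by
  rw [Matrix.sub_apply, Matrix.sub_apply, map_sub, hM, hN]

theorem inv [Fintype n] [DecidableEq n] {M : Matrix n n ℂ} (hM : ConjEquivariant τ τ M) :
    ConjEquivariant τ τ M⁻¹ := by
  -- The entrywise conjugate, written as conjugate transpose followed by transpose, commutes with
  -- inversion.
  have h : Mᴴᵀ = M.submatrix τ τ := by ext a b; exact hM a b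
  have h2 : M⁻¹ᴴᵀ = M⁻¹.submatrix τ τ := by
    rw [conjTranspose_nonsing_inv, transpose_nonsing_inv, h, inv_submatrix_equiv]
  exact fun a b => congrFun (congrFun h2 a) b

theorem diagonal [DecidableEq n] {d : n → ℂ} (hd : ∀ a, (starRingEnd ℂ) (d a) = d (τ a)) :
    ConjEquivariant τ τ (Matrix.diagonal d) := by
  intro a b
  by_cases h : a = b
  · subst h; simp [hd]
  · simp [h]

/-- Rows and columns are permuted by the same `τ`, so the two signs cancel. This makes `det K_{LR}`
real. -/
theorem conj_det [Fintype n] [DecidableEq n] {M : Matrix n n ℂ} (hM : ConjEquivariant τ τ M) :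
    (starRingEnd ℂ) M.det = M.det := by
  have h : (starRingEnd ℂ).mapMatrix M = M.submatrix τ τ := by ext a b; exact hM a b
  rw [RingHom.map_det, h, det_submatrix_equiv_self]

end ConjEquivariant

/-- Exchange of the unbarred and the barred labels of a group. -/
abbrev swapD (n : ℕ) : Dbl n ≃ Dbl n := Equiv.sumComm _ _

theorem conjEquivariant_jD {n : ℕ} : ConjEquivariant (swapD n) (swapD n) (diagonal jD) :=
  ConjEquivariant.diagonal fun a => by rcases a with a | a <;> simp [jD]

section Metric

variable {K : Pt dc dt ds → ℝ} {p : Pt dc dt ds}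

theorem conjEquivariant_KLR (hK : ContDiffAt ℝ 2 K p) :
    ConjEquivariant (swapD ds) (swapD ds) (KLR K p) := fun a b => conj_hess hK (fL a) (fR b)

theorem ConjEquivariant.commL {n : ℕ} {M : Matrix (Dbl ds) (Dbl n) ℂ}
    (hM : ConjEquivariant (swapD ds) (swapD n) M) :
    ConjEquivariant (swapD ds) (swapD n) (commL M) :=
  (conjEquivariant_jD.mul hM).sub (hM.mul conjEquivariant_jD)

theorem conjEquivariant_Jplus (hK : ContDiffAt ℝ 2 K p) : ConjEquivariant bar bar (Jplus K p) := by
  have hP := (conjEquivariant_KLR hK).inv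
  have hLL : ConjEquivariant (swapD ds) (swapD ds) ((hess K p).submatrix fL fL) :=
    fun a b => conj_hess hK (fL a) (fL b)
  have hLC : ConjEquivariant (swapD ds) (swapD dc) ((hess K p).submatrix fL fC) :=
    fun a b => conj_hess hK (fL a) (fC b)
  have hLT : ConjEquivariant (swapD ds) (swapD dt) ((hess K p).submatrix fL fT) :=
    fun a b => conj_hess hK (fL a) (fT b)
  rintro ((a | a) | (a | a)) ((b | b) | (b | b))
  · exact conjEquivariant_jD a b
  · exact map_zero _
  · exact map_zero _
  · exact map_zero _
  · exact hP.mul hLL.commL a b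
  · exact (hP.mul conjEquivariant_jD).mul (conjEquivariant_KLR hK) a b
  · exact hP.mul hLC.commL a b
  · exact hP.mul hLT.commL a b
  · exact map_zero _
  · exact map_zero _
  · exact conjEquivariant_jD a b
  · exact map_zero _
  · exact map_zero _
  · exact map_zero _
  · exact map_zero _
  · exact conjEquivariant_jD a b

theorem conjEquivariant_frameMetric (hK : ContDiffAt ℝ 2 K p) :
    ConjEquivariant bar bar (frameMetric K p) := by
  have hw : ∀ A : Frame dc dt ds, (starRingEnd ℂ) ((jF * weight 0 (-1) (-1) 1 : _ → ℂ) A) =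
      (jF * weight 0 (-1) (-1) 1 : _ → ℂ) (bar A) := by
    intro A
    have := conj_weight 0 (-1) (-1) 1 A
    push_cast at this
    simp [this]
  have hM : ConjEquivariant bar bar (dMatrix K (jF * weight 0 (-1) (-1) 1) p) := by
    intro A B
    simp only [dMatrix, of_apply, map_mul, map_sub, conj_hess hK, hw]
  have h := hM.mul (conjEquivariant_Jplus hK)
  intro A B
  simp only [frameMetric, Matrix.smul_apply, Matrix.add_apply, transpose_apply, smul_eq_mul,
    map_mul, map_add, h A B, h B A, map_div₀, map_one, map_ofNat]

/-- The matrix of coordinate one-forms on the coordinate vector fields. -/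
noncomputable def frameMatrix (dc dt ds : ℕ) : Matrix (Frame dc dt ds) (Idx dc dt ds × Fin 2) ℂ :=
  of fun A m => dz A (realVec m)

/-- Taking real parts in `metric` discards nothing: conjugation merely relabels the double sum by
`bar`. -/
theorem ofReal_metric (hK : ContDiffAt ℝ 2 K p) :
    (metric K p).map Complex.ofReal =
      (frameMatrix dc dt ds)ᵀ * frameMetric K p * frameMatrix dc dt ds := by
  ext m n
  have h1 : ((frameMatrix dc dt ds)ᵀ * frameMetric K p * frameMatrix dc dt ds) m n =
      ∑ A, ∑ B, frameMetric K p A B * dz A (realVec m) * dz B (realVec n) := by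
    simp only [mul_apply, Finset.sum_mul, transpose_apply, frameMatrix, of_apply]
    rw [Finset.sum_comm]
    exact Finset.sum_congr rfl fun A _ => Finset.sum_congr rfl fun B _ => by ring
  rw [h1, map_apply, metric, of_apply]
  refine Complex.conj_eq_iff_re.1 ?_
  rw [map_sum]
  refine Fintype.sum_equiv bar _ _ fun A => ?_
  rw [map_sum]
  refine Fintype.sum_equiv bar _ _ fun B => ?_
  rw [map_mul, map_mul, conj_dz, conj_dz, conjEquivariant_frameMetric hK]

end Metric

theorem frameMatrix_mul_exists : ∃ F : Matrix (Idx dc dt ds × Fin 2) (Frame dc dt ds) ℂ,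
    frameMatrix dc dt ds * F = 1 := by
  -- The columns of the witness are the real components of `∂_A = (∂_x ∓ i ∂_y) / 2`.
  refine ⟨of fun m A => if m.1 = base A then (if m.2 = 0 then 1 / 2 else -jF A / 2) else 0, ?_⟩
  ext A B
  rw [mul_apply, Fintype.sum_prod_type, Finset.sum_eq_single (base B)]
  · have h := coeff_dz B A
    rw [coeff_apply] at h
    simp only [Fin.sum_univ_two, frameMatrix, of_apply, realVec, if_true, one_ne_zero, if_false]
    rw [one_apply]
    simp only [eq_comm (a := A)]
    rw [← h]
    ring
  · intro j _ hj
    simp [hj]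
  · simp

theorem ofReal_det_metric : ∃ C : ℂ, C ≠ 0 ∧ ∀ (K : Pt dc dt ds → ℝ) (p : Pt dc dt ds),
    ContDiffAt ℝ 2 K p → ((metric K p).det : ℂ) = C * (frameMetric K p).det := by
  obtain ⟨F, hF⟩ := frameMatrix_mul_exists (dc := dc) (dt := dt) (ds := ds)
  -- The rows and columns of `frameMatrix` carry different label types; any bijection will do, since
  -- the determinant of the resulting square matrix enters squared.
  let e : Idx dc dt ds × Fin 2 ≃ Frame dc dt ds := Fintype.equivOfCardEq (by simp; ring)
  have hne : ((frameMatrix dc dt ds).submatrix e id).det ≠ 0 := by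
    intro h0
    have h := congrArg (fun M => (Matrix.submatrix M e e).det) hF
    simp only [submatrix_one_equiv, det_one] at h
    rw [← submatrix_mul_equiv _ _ _ (Equiv.refl _), det_mul] at h
    simp only [Equiv.coe_refl, h0, zero_mul] at h
    exact zero_ne_one h
  refine ⟨_, mul_ne_zero hne hne, fun K p hK => ?_⟩
  have h1 : ((metric K p).det : ℂ) = ((metric K p).map Complex.ofReal).det :=
    RingHom.map_det Complex.ofRealHom (metric K p)
  have h2 : (frameMatrix dc dt ds)ᵀ * frameMetric K p * frameMatrix dc dt ds =
      ((frameMatrix dc dt ds).submatrix e id)ᵀ * (frameMetric K p).submatrix e e *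
        (frameMatrix dc dt ds).submatrix e id := by
    rw [transpose_submatrix, submatrix_mul_equiv, submatrix_mul_equiv, submatrix_id_id]
  rw [h1, ofReal_metric hK, h2, det_mul, det_mul, det_transpose, det_submatrix_equiv_self]
  ring

/-! ## Determinants of block matrices -/

section Blocks

variable {ι : Type*} [Fintype ι] [DecidableEq ι]

/-- The constant is the determinant of the block swap, nonzero because the swap is an involution. -/
theorem det_fromBlocks_antidiagonal : ∃ s : ℂ, s ≠ 0 ∧ ∀ X Y : Matrix ι ι ℂ,
    (fromBlocks 0 X Y 0).det = s * (X.det * Y.det) := by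
  set T : Matrix (ι ⊕ ι) (ι ⊕ ι) ℂ := fromBlocks 0 1 1 0 with hT
  have hTT : T * T = 1 := by
    simp [hT, fromBlocks_multiply]
  have hdet : T.det * T.det = 1 := by rw [← det_mul, hTT, det_one]
  refine ⟨T.det, left_ne_zero_of_mul_eq_one hdet, fun X Y => ?_⟩
  have h : fromBlocks 0 X Y 0 = fromBlocks X 0 0 Y * T := by
    simp [hT, fromBlocks_multiply]
  rw [h, det_mul, det_fromBlocks_zero₂₁, mul_comm]

/-- The determinant of a symmetric matrix pairing the labels `a` with the labels `b`. -/
theorem det_of_paired {κ : Type*} [Fintype κ] [DecidableEq κ] {a b : ι → κ}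
    (hE : Function.Bijective (Sum.elim a b)) : ∃ s : ℂ, s ≠ 0 ∧ ∀ M : Matrix κ κ ℂ,
      (∀ i j, M (a i) (a j) = 0) → (∀ i j, M (b i) (b j) = 0) →
      M.det = s * ((M.submatrix a b).det * (M.submatrix b a).det) := by
  obtain ⟨s, hs, h⟩ := det_fromBlocks_antidiagonal (ι := ι)
  refine ⟨s, hs, fun M ha hb => ?_⟩
  rw [← det_submatrix_equiv_self (Equiv.ofBijective _ hE) M, ← h]
  congr 1
  ext (i | i) (j | j)
  · exact ha i j
  · rfl
  · rfl
  · exact hb i j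

/-- The determinant of the two-form `∑ w_x H_{xy} dz^x ∧ dz^y` pairing the labels `a`, of weight
`i`, with the labels `b`, of weight `-i`. -/
theorem det_of_weighted {κ : Type*} [Fintype κ] [DecidableEq κ] {a b : ι → κ}
    (hE : Function.Bijective (Sum.elim a b)) {w : κ → ℂ} (ha : ∀ i, w (a i) = Complex.I)
    (hb : ∀ i, w (b i) = -Complex.I) : ∃ s : ℂ, s ≠ 0 ∧ ∀ H : Matrix κ κ ℂ, Hᵀ = H →
      (of fun x y => (w x - w y) * H x y).det = s * (H.submatrix a b).det ^ 2 := by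
  obtain ⟨s, hs, h⟩ := det_of_paired hE
  refine ⟨s * ((2 * Complex.I) ^ Fintype.card ι * (-2 * Complex.I) ^ Fintype.card ι), by simp [hs],
    fun H hH => ?_⟩
  rw [h _ (fun i j => by simp [ha]) (fun i j => by simp [hb])]
  have h1 : (of fun x y => (w x - w y) * H x y).submatrix a b =
      (2 * Complex.I) • H.submatrix a b := by
    ext i j
    simp only [submatrix_apply, of_apply, Matrix.smul_apply, ha, hb, smul_eq_mul]
    ring
  have h2 : (of fun x y => (w x - w y) * H x y).submatrix b a =
      (-2 * Complex.I) • (H.submatrix a b)ᵀ := by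
    ext i j
    simp only [submatrix_apply, of_apply, Matrix.smul_apply, ha, hb, smul_eq_mul, transpose_apply]
    rw [← congrFun (congrFun hH (b i)) (a j), transpose_apply]
    ring
  rw [h1, h2, det_smul, det_smul, det_transpose]
  ring

/-- The metric in block form is a product of three matrices of two-forms. -/
theorem block_metric_factor {A P D j : Matrix ι ι ℂ} (hj : j * j = -1) (hjT : jᵀ = j) (hA : Aᵀ = A)
    (hD : Dᵀ = D) (hP : IsUnit P.det) :
    let M := fromBlocks 0 (-(P * j)) (j * Pᵀ) (j * D - D * j)
    let J := fromBlocks j 0 (P⁻¹ * (j * A - A * j)) (P⁻¹ * j * P)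
    M * J + (M * J)ᵀ =
      fromBlocks (j * A - A * j) (j * P - P * j) (j * Pᵀ - Pᵀ * j) (j * D - D * j) *
      fromBlocks 0 (-(P⁻¹)ᵀ) P⁻¹ 0 *
      fromBlocks (j * A - A * j) (j * P + P * j) (-(j * Pᵀ + Pᵀ * j)) (-(j * D - D * j)) := by
  intro M J
  have h1 : P * P⁻¹ = 1 := mul_nonsing_inv P hP
  have h2 : P⁻¹ * P = 1 := nonsing_inv_mul P hP
  have h3 : (P⁻¹)ᵀ * Pᵀ = 1 := by rw [← transpose_mul, h1, transpose_one]
  have h4 : Pᵀ * (P⁻¹)ᵀ = 1 := by rw [← transpose_mul, h2, transpose_one]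
  have hjj (X : Matrix ι ι ℂ) : j * (j * X) = -X := by rw [← mul_assoc, hj, neg_one_mul]
  have h2' (X : Matrix ι ι ℂ) : P⁻¹ * (P * X) = X := by rw [← mul_assoc, h2, one_mul]
  have h3' (X : Matrix ι ι ℂ) : (P⁻¹)ᵀ * (Pᵀ * X) = X := by rw [← mul_assoc, h3, one_mul]
  simp only [M, J, fromBlocks_multiply, fromBlocks_transpose, fromBlocks_add, transpose_add,
    transpose_sub, transpose_mul, transpose_neg, hjT, hA, hD, transpose_transpose,
    zero_mul, mul_zero, zero_add, add_zero, neg_mul, mul_neg, neg_neg]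
  congr 1 <;>
  · simp only [mul_add, mul_sub, sub_mul, mul_assoc, hjj, h1, h4, h2', h3', hj, mul_neg, mul_one]
    abel

/-- In `block_metric_factor` the middle matrix is antidiagonal, with determinant a constant times
`(det P⁻¹) ^ 2`; the factor `P.det ^ 2` on the left clears it. -/
theorem det_block_metric : ∃ s : ℂ, s ≠ 0 ∧ ∀ A P D j : Matrix ι ι ℂ, j * j = -1 → jᵀ = j →
    Aᵀ = A → Dᵀ = D → IsUnit P.det →
    let M := fromBlocks 0 (-(P * j)) (j * Pᵀ) (j * D - D * j)
    let J := fromBlocks j 0 (P⁻¹ * (j * A - A * j)) (P⁻¹ * j * P)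
    ((1 / 2 : ℂ) • (M * J + (M * J)ᵀ)).det * P.det ^ 2 = s *
      ((fromBlocks (j * A - A * j) (j * P - P * j) (j * Pᵀ - Pᵀ * j) (j * D - D * j)).det *
      (fromBlocks (j * A - A * j) (j * P + P * j) (-(j * Pᵀ + Pᵀ * j)) (-(j * D - D * j))).det) := by
  obtain ⟨s, hs, h⟩ := det_fromBlocks_antidiagonal (ι := ι)
  refine ⟨(1 / 2) ^ Fintype.card (ι ⊕ ι) * (s * (-1) ^ Fintype.card ι), by simp [hs], ?_⟩
  intro A P D j hj hjT hA hD hP M J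
  have hinv : P⁻¹.det * P.det = 1 := by
    rw [← det_mul, nonsing_inv_mul P hP, det_one]
  have hf : M * J + (M * J)ᵀ = _ := block_metric_factor hj hjT hA hD hP
  rw [hf, det_smul, det_mul, det_mul, h, det_neg, det_transpose]
  -- With `x = det P⁻¹ * det P`, this uses `x ^ 2 - 1 = (x + 1) * (x - 1)`.
  linear_combination ((1 / 2) ^ Fintype.card (ι ⊕ ι) * (s * (-1) ^ Fintype.card ι) *
      ((fromBlocks (j * A - A * j) (j * P - P * j) (j * Pᵀ - Pᵀ * j) (j * D - D * j)).det *
      (fromBlocks (j * A - A * j) (j * P + P * j) (-(j * Pᵀ + Pᵀ * j))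
        (-(j * D - D * j))).det)) * (P⁻¹.det * P.det + 1) * hinv

end Blocks

/-! ## The determinant of the metric without chiral and twisted chiral coordinates -/

theorem detA_eq (K : Pt dc dt ds → ℝ) (p : Pt dc dt ds) :
    detA K p = ((hess K p).submatrix (Sum.elim l rb) (Sum.elim lb r)).det := by
  rw [detA]
  congr 1
  ext (i | i) (j | j) <;> rfl

theorem detB_eq (K : Pt dc dt ds → ℝ) (p : Pt dc dt ds) :
    detB K p = ((hess K p).submatrix (Sum.elim l r) (Sum.elim rb lb)).det := by
  rw [detB]
  congr 1
  ext (i | i) (j | j) <;> rfl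

theorem jD_mul_self {n : ℕ} (a : Dbl n) : jD a * jD a = -1 := by
  rcases a with a | a <;> simp [jD]

/-- The outer factors of the metric have entries `(w x - w y) * K_{xy}`, for the weights `(J, J)`
and `(J, -J)` on `(X_L, X_R)`. Sorting labels by the value `i` or `-i` of `w` gives the label
groupings of `detB` and `detA`, and `det_of_weighted` supplies their squares. -/
theorem det_metric_semichiral {n : ℕ} : ∃ C : ℂ, C ≠ 0 ∧
    ∀ (K : Pt 0 0 n → ℝ) (p : Pt 0 0 n), ContDiffAt ℝ 2 K p → (KLR K p).det ≠ 0 →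
      ((metric K p).det : ℂ) * (KLR K p).det ^ 2 = C * (detA K p * detB K p) ^ 2 := by
  obtain ⟨C, hC, h⟩ := ofReal_det_metric (dc := 0) (dt := 0) (ds := n)
  obtain ⟨s, hs, hblock⟩ := det_block_metric (ι := Dbl n)
  have hB : Function.Bijective (Sum.elim
      (Sum.elim (Sum.inl ∘ Sum.inl) (Sum.inr ∘ Sum.inl) : Fin n ⊕ Fin n → Dbl n ⊕ Dbl n)
      (Sum.elim (Sum.inr ∘ Sum.inr) (Sum.inl ∘ Sum.inr))) := by
    refine (Fintype.bijective_iff_surjective_and_card _).2 ⟨?_, by simp⟩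
    rintro ((i | i) | (i | i))
    · exact ⟨.inl (.inl i), rfl⟩
    · exact ⟨.inr (.inr i), rfl⟩
    · exact ⟨.inl (.inr i), rfl⟩
    · exact ⟨.inr (.inl i), rfl⟩
  have hA : Function.Bijective (Sum.elim
      (Sum.elim (Sum.inl ∘ Sum.inl) (Sum.inr ∘ Sum.inr) : Fin n ⊕ Fin n → Dbl n ⊕ Dbl n)
      (Sum.elim (Sum.inl ∘ Sum.inr) (Sum.inr ∘ Sum.inl))) := by
    refine (Fintype.bijective_iff_surjective_and_card _).2 ⟨?_, by simp⟩
    rintro ((i | i) | (i | i))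
    · exact ⟨.inl (.inl i), rfl⟩
    · exact ⟨.inr (.inl i), rfl⟩
    · exact ⟨.inr (.inr i), rfl⟩
    · exact ⟨.inl (.inr i), rfl⟩
  obtain ⟨sA, hsA, hdA⟩ := det_of_weighted hA (w := Sum.elim jD (-jD))
    (by rintro (i | i) <;> simp [jD]) (by rintro (i | i) <;> simp [jD])
  obtain ⟨sB, hsB, hdB⟩ := det_of_weighted hB (w := Sum.elim jD jD)
    (by rintro (i | i) <;> simp [jD]) (by rintro (i | i) <;> simp [jD])
  refine ⟨C * s * sA * sB, by simp [hC, hs, hsA, hsB], fun K p hK hdet => ?_⟩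
  have hsymm : ((hess K p).submatrix Sum.inl Sum.inl)ᵀ = (hess K p).submatrix Sum.inl Sum.inl := by
    ext x y
    exact hess_symm hK _ _
  have hblock' := hblock ((hess K p).submatrix fL fL) (KLR K p) ((hess K p).submatrix fR fR)
    (diagonal jD) (by
      rw [diagonal_mul_diagonal, ← diagonal_one, diagonal_neg]
      congr 1
      funext a
      exact jD_mul_self a) (diagonal_transpose _)
    (by ext a b; exact hess_symm hK _ _) (by ext a b; exact hess_symm hK _ _)
    (isUnit_iff_ne_zero.2 hdet)
  simp only at hblock'
  have hG : (frameMetric K p).det = ((frameMetric K p).submatrix Sum.inl Sum.inl).det :=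
    (det_submatrix_equiv_self (Equiv.sumEmpty (Dbl n ⊕ Dbl n) (Dbl 0 ⊕ Dbl 0)).symm _).symm
  have hM : (dMatrix K (jF * weight 0 (-1) (-1) 1) p).submatrix Sum.inl Sum.inl =
      fromBlocks 0 (-(KLR K p * diagonal jD)) (diagonal jD * (KLR K p)ᵀ)
        (diagonal jD * (hess K p).submatrix fR fR - (hess K p).submatrix fR fR * diagonal jD) := by
    ext (a | a) (b | b)
    · simp [dMatrix, weight]
    · simp [dMatrix, weight, jF, KLR, fL, fR]
    · simp only [dMatrix, weight, jF, submatrix_apply, of_apply, fromBlocks_apply₂₁,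
        diagonal_mul, transpose_apply, KLR, fL, fR, Pi.mul_apply, Sum.elim_inl, Sum.elim_inr]
      rw [hess_symm hK]
      ring
    · simp only [dMatrix, weight, jF, submatrix_apply, of_apply, fromBlocks_apply₂₂, Matrix.sub_apply,
        diagonal_mul, mul_diagonal, fR, Pi.mul_apply, Sum.elim_inl, Sum.elim_inr]
      ring
  have hGe : (frameMetric K p).submatrix Sum.inl Sum.inl = (1 / 2 : ℂ) •
      ((dMatrix K (jF * weight 0 (-1) (-1) 1) p).submatrix Sum.inl Sum.inl *
        (Jplus K p).submatrix Sum.inl Sum.inl +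
      ((dMatrix K (jF * weight 0 (-1) (-1) 1) p).submatrix Sum.inl Sum.inl *
        (Jplus K p).submatrix Sum.inl Sum.inl)ᵀ) := by
    -- The `φ` and `χ` blocks are empty here, so restriction to the semichiral labels respects
    -- products.
    have hmul (M N : Matrix (Frame 0 0 n) (Frame 0 0 n) ℂ) :
        (M * N).submatrix Sum.inl Sum.inl = M.submatrix Sum.inl Sum.inl *
          N.submatrix (Sum.inl : Dbl n ⊕ Dbl n → _) Sum.inl := by
      ext x y
      simp [mul_apply]
    rw [← hmul]
    rfl
  have hJ : (Jplus K p).submatrix Sum.inl Sum.inl = fromBlocks (diagonal jD) 0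
      ((KLR K p)⁻¹ * (diagonal jD * (hess K p).submatrix fL fL -
        (hess K p).submatrix fL fL * diagonal jD)) ((KLR K p)⁻¹ * diagonal jD * KLR K p) := by
    ext x y
    rfl
  have hWB : fromBlocks
      (diagonal jD * (hess K p).submatrix fL fL - (hess K p).submatrix fL fL * diagonal jD)
      (diagonal jD * KLR K p - KLR K p * diagonal jD)
      (diagonal jD * (KLR K p)ᵀ - (KLR K p)ᵀ * diagonal jD)
      (diagonal jD * (hess K p).submatrix fR fR - (hess K p).submatrix fR fR * diagonal jD) =
      of fun x y => ((Sum.elim jD jD : Dbl n ⊕ Dbl n → ℂ) x - (Sum.elim jD jD) y) *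
        (hess K p).submatrix Sum.inl Sum.inl x y := by
    ext (a | a) (b | b)
    · simp [fL]; ring
    · simp [KLR, fL, fR]; ring
    · simp [KLR, fL, fR, hess_symm hK (Sum.inl (Sum.inl b))]; ring
    · simp [fR]; ring
  have hWA : fromBlocks
      (diagonal jD * (hess K p).submatrix fL fL - (hess K p).submatrix fL fL * diagonal jD)
      (diagonal jD * KLR K p + KLR K p * diagonal jD)
      (-(diagonal jD * (KLR K p)ᵀ + (KLR K p)ᵀ * diagonal jD))
      (-(diagonal jD * (hess K p).submatrix fR fR - (hess K p).submatrix fR fR * diagonal jD)) =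
      of fun x y => ((Sum.elim jD (-jD) : Dbl n ⊕ Dbl n → ℂ) x - (Sum.elim jD (-jD)) y) *
        (hess K p).submatrix Sum.inl Sum.inl x y := by
    ext (a | a) (b | b)
    · simp [fL]; ring
    · simp [KLR, fL, fR]; ring
    · simp [KLR, fL, fR, hess_symm hK (Sum.inl (Sum.inl b))]; ring
    · simp [fR]; ring
  rw [← hM, ← hJ, ← hGe, hWA, hWB, hdA _ hsymm, hdB _ hsymm, ← hG] at hblock'
  have hA' : detA K p = (((hess K p).submatrix Sum.inl Sum.inl).submatrix
      (Sum.elim (Sum.inl ∘ Sum.inl) (Sum.inr ∘ Sum.inr) : Fin n ⊕ Fin n → Dbl n ⊕ Dbl n)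
      (Sum.elim (Sum.inl ∘ Sum.inr) (Sum.inr ∘ Sum.inl))).det := by
    rw [detA]
    congr 1
    ext (i | i) (j | j) <;> rfl
  have hB' : detB K p = (((hess K p).submatrix Sum.inl Sum.inl).submatrix
      (Sum.elim (Sum.inl ∘ Sum.inl) (Sum.inr ∘ Sum.inl) : Fin n ⊕ Fin n → Dbl n ⊕ Dbl n)
      (Sum.elim (Sum.inr ∘ Sum.inr) (Sum.inl ∘ Sum.inr))).det := by
    rw [detB]
    congr 1
    ext (i | i) (j | j) <;> rfl
  rw [h K p hK, mul_assoc, hblock', ← hA', ← hB']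
  ring

/-! ## The metric without semichiral coordinates -/

theorem exists_eq_inr {m n : ℕ} (A : Frame m n 0) : ∃ x, A = Sum.inr x := by
  rcases A with ((i | i) | (i | i)) | x
  · exact i.elim0
  · exact i.elim0
  · exact i.elim0
  · exact i.elim0
  · exact ⟨x, rfl⟩

/-- With `J₊` diagonal the metric is explicit. The factor `1 + jF A * jF B` vanishes unless exactly
one label is barred, and the sum of weights vanishes on mixed `φ`, `χ` pairs, leaving `2 K_{cc̄}`
and `-2 K_{tt̄}`. -/
theorem frameMetric_apply_of_no_semichiral {m n : ℕ} {K : Pt m n 0 → ℝ} {p : Pt m n 0}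
    (hK : ContDiffAt ℝ 2 K p) (A B : Frame m n 0) :
    frameMetric K p A B = 1 / 2 * hess K p A B * (1 + jF A * jF B) *
      (weight 0 0 1 (-1) A + weight 0 0 1 (-1) B) := by
  have hJ : Jplus K p = diagonal jF := by
    ext A B
    obtain ⟨A, rfl⟩ := exists_eq_inr A
    obtain ⟨B, rfl⟩ := exists_eq_inr B
    rcases A with A | A <;> rcases B with B | B <;> simp [Jplus, jF, diagonal_apply]
  have hw (A : Frame m n 0) : (jF * weight 0 (-1) (-1) 1 : _ → ℂ) A =
      -weight 0 0 1 (-1) A * jF A := by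
    obtain ⟨A, rfl⟩ := exists_eq_inr A
    rcases A with A | A <;> simp [weight]
  rw [frameMetric, hJ]
  simp only [Matrix.smul_apply, Matrix.add_apply, transpose_apply, mul_diagonal, dMatrix, of_apply,
    hw, smul_eq_mul, hess_symm hK B A]
  linear_combination (-(1 / 2) * hess K p A B * weight 0 0 1 (-1) B) * jF_mul_self B +
    (-(1 / 2) * hess K p A B * weight 0 0 1 (-1) A) * jF_mul_self A

theorem det_metric_of_no_semichiral {m n : ℕ} : ∃ C : ℂ, C ≠ 0 ∧
    ∀ (K : Pt m n 0 → ℝ) (p : Pt m n 0), ContDiffAt ℝ 2 K p →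
      ((metric K p).det : ℂ) = C * ((Kcc K p).det * (Ktt K p).det) ^ 2 := by
  obtain ⟨C, hC, h⟩ := ofReal_det_metric (dc := m) (dt := n) (ds := 0)
  have hE : Function.Bijective (Sum.elim (Sum.elim c t) (Sum.elim cb tb) :
      (Fin m ⊕ Fin n) ⊕ (Fin m ⊕ Fin n) → Frame m n 0) := by
    refine (Fintype.bijective_iff_surjective_and_card _).2 ⟨?_, by simp; ring⟩
    intro A
    obtain ⟨(i | i) | (i | i), rfl⟩ := exists_eq_inr A
    · exact ⟨.inl (.inl i), rfl⟩
    · exact ⟨.inr (.inl i), rfl⟩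
    · exact ⟨.inl (.inr i), rfl⟩
    · exact ⟨.inr (.inr i), rfl⟩
  obtain ⟨s, hs, hdet⟩ := det_of_paired hE
  refine ⟨C * s * (2 ^ m * (-2) ^ n) ^ 2, by simp [hC, hs], fun K p hK => ?_⟩
  have hj : Complex.I * Complex.I = -1 := Complex.I_mul_I
  have hX : (frameMetric K p).submatrix (Sum.elim c t) (Sum.elim cb tb) =
      fromBlocks ((2 : ℂ) • Kcc K p) 0 0 ((-2 : ℂ) • Ktt K p) := by
    ext (i | i) (j | j) <;>
      simp [frameMetric_apply_of_no_semichiral hK, Kcc, Ktt, c, cb, t, tb, fC, fT, weight, jF, jD] <;>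
      ring
  have hX' : (frameMetric K p).submatrix (Sum.elim cb tb) (Sum.elim c t) =
      ((frameMetric K p).submatrix (Sum.elim c t) (Sum.elim cb tb))ᵀ := by
    ext i j
    simp only [submatrix_apply, transpose_apply, frameMetric_apply_of_no_semichiral hK]
    rw [hess_symm hK]
    ring
  rw [h K p hK, hdet, hX', det_transpose, hX, det_fromBlocks_zero₂₁, det_smul, det_smul,
    Fintype.card_fin, Fintype.card_fin]
  · ring
  · rintro (i | i) (j | j) <;>
      simp [frameMetric_apply_of_no_semichiral hK, c, t, fC, fT, weight, jF, jD]
  · rintro (i | i) (j | j) <;>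
      simp [frameMetric_apply_of_no_semichiral hK, cb, tb, fC, fT, weight, jF, jD]

/-- The real components of the chiral vector with complex components `x`. -/
def chiralVec {m n : ℕ} (x : Fin m → ℂ) : Idx m n 0 × Fin 2 → ℝ := fun k =>
  Sum.elim (fun _ => 0) (Sum.elim (fun i => if k.2 = 0 then (x i).re else (x i).im) fun _ => 0) k.1

/-- On real vectors in the chiral directions, `g` is four times the Hermitian form of `K_{cc̄}`.
Positivity of `g` thus makes `K_{cc̄}` positive definite, with positive real determinant. -/
theorem posDef_Kcc {m n : ℕ} {K : Pt m n 0 → ℝ} {p : Pt m n 0} (hK : ContDiffAt ℝ 2 K p)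
    (hg : (metric K p).PosDef) : 0 < (Kcc K p).det.re ∧ (Kcc K p).det.im = 0 := by
  open scoped ComplexOrder in
  have hpos : (Kcc K p).PosDef := by
    have hherm : (Kcc K p).IsHermitian := by
      ext i j
      have h1 : (starRingEnd ℂ) (hess K p (c j) (cb i)) = hess K p (cb j) (c i) :=
        conj_hess hK _ _
      exact h1.trans (hess_symm hK _ _)
    refine PosDef.of_dotProduct_mulVec_pos hherm fun y hy => ?_
    have hreal := hherm.im_star_dotProduct_mulVec_self y
    -- The row index of `K_{cc̄}` is unbarred, so the conjugate of `y` supplies the holomorphic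
    -- components.
    set x : Fin m → ℂ := star y with hx
    set v : Idx m n 0 × Fin 2 → ℝ := chiralVec x with hv
    have hv0 : v ≠ 0 := by
      intro h0
      apply hy
      have : x = 0 := by
        ext i
        have h1 := congrFun h0 (Sum.inr (Sum.inl i), 0)
        have h2 := congrFun h0 (Sum.inr (Sum.inl i), 1)
        exact Complex.ext (by simpa [hv, chiralVec] using h1) (by simpa [hv, chiralVec] using h2)
      simpa [hx] using this
    have hgv := hg.dotProduct_mulVec_pos hv0
    have hcast : ((v ⬝ᵥ (metric K p *ᵥ v) : ℝ) : ℂ) = 4 * (star y ⬝ᵥ (Kcc K p *ᵥ y)) := by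
      set V : Idx m n 0 × Fin 2 → ℂ := fun k => (v k : ℂ) with hV
      have h1 : ((v ⬝ᵥ (metric K p *ᵥ v) : ℝ) : ℂ) =
          V ⬝ᵥ ((metric K p).map Complex.ofReal *ᵥ V) := by
        simp [dotProduct, mulVec, hV]
      have h2 : frameMatrix m n 0 *ᵥ V =
          Sum.elim (fun _ => 0) (Sum.elim (Sum.elim x (star x)) fun _ => 0) := by
        ext A
        simp only [mulVec, dotProduct, frameMatrix, of_apply, realVec, dz_apply, hV, hv, chiralVec]
        rw [Fintype.sum_prod_type, Finset.sum_eq_single (base A) (fun j _ hj => by simp [hj.symm])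
          (by simp)]
        simp only [Fin.sum_univ_two, Pi.single_eq_same]
        obtain ⟨(i | i) | i, rfl⟩ := exists_eq_inr A <;> apply Complex.ext <;>
          simp [base, jF, jD]
      -- The `c̄c` and `cc̄` blocks contribute equally by symmetry of the Hessian; each carries a
      -- factor `2`, hence the `4` in `hcast`.
      have h3 : ∑ i, ∑ j, star (x i) * (hess K p (cb i) (c j) * x j) =
          ∑ i, ∑ j, x i * (hess K p (c i) (cb j) * star (x j)) := by
        rw [Finset.sum_comm]
        refine Finset.sum_congr rfl fun i _ => Finset.sum_congr rfl fun j _ => ?_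
        rw [hess_symm hK]
        ring
      rw [h1, ofReal_metric hK, ← mulVec_mulVec, ← mulVec_mulVec, dotProduct_mulVec,
        vecMul_transpose, h2]
      simp only [dotProduct, mulVec, frameMetric_apply_of_no_semichiral hK, Finset.mul_sum]
      simp [Fintype.sum_sum_type, weight, jF, jD, Kcc]
      trans 2 * (∑ i, ∑ j, x i * (hess K p (c i) (cb j) * star (x j))) +
        2 * ∑ i, ∑ j, star (x i) * (hess K p (cb i) (c j) * x j)
      · congr 1 <;>
        · simp only [Finset.mul_sum]
          refine Finset.sum_congr rfl fun i _ => Finset.sum_congr rfl fun j _ => ?_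
          simp only [c, cb, fC, ← starRingEnd_apply]
          ring
      · rw [h3, ← two_mul, ← mul_assoc]
        simp only [Finset.mul_sum]
        refine Finset.sum_congr rfl fun i _ => Finset.sum_congr rfl fun j _ => ?_
        simp only [hx, Pi.star_apply, star_star, starRingEnd_apply]
        ring
    rw [star_trivial] at hgv
    have him : (star y ⬝ᵥ (Kcc K p *ᵥ y)).im = 0 := hreal
    rw [Complex.pos_iff]
    have hre := congrArg Complex.re hcast
    rw [Complex.ofReal_re] at hre
    refine ⟨?_, him.symm⟩
    have h4 : (4 * (star y ⬝ᵥ (Kcc K p *ᵥ y))).re = 4 * (star y ⬝ᵥ (Kcc K p *ᵥ y)).re := by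
      simp
    linarith
  have := hpos.det_pos
  rw [Complex.pos_iff] at this
  exact ⟨this.1, this.2.symm⟩

/-! ## The Monge-Ampère equation and the dilatons in terms of determinants -/

theorem genMongeAmpere_iff (α : ℝ) (U : Set (Pt dc dt ds)) (K : Pt dc dt ds → ℝ) :
    GenMongeAmpere 0 0 α U K ↔ ∀ p ∈ U,
      (-1) ^ (ds * dc) * (-leftMatrix K p).det = α * (rightMatrix K p).det := by
  simp [GenMongeAmpere, leftMatrix, rightMatrix]

/-- The volume form is nonzero, so coefficients may be compared, and the universal constants of the
pairings are absorbed into `κ₁` and `κ₂`. -/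
theorem isDilaton_iff {U : Set (Pt dc dt ds)} {K : Pt dc dt ds → ℝ} (hU : IsOpen U)
    (hK : ContDiffOn ℝ ((⊤ : ℕ∞) : WithTop ℕ∞) K U) (Φ : Pt dc dt ds → ℝ) :
    IsDilaton 0 0 U K Φ ↔ ∃ κ₁ κ₂ : ℂ, κ₁ ≠ 0 ∧ κ₂ ≠ 0 ∧ ∀ p ∈ U,
      κ₁ * (leftMatrix K p).det = (Real.exp (-2 * Φ p) * Real.sqrt (metric K p).det : ℝ) ∧
      κ₂ * (rightMatrix K p).det = (Real.exp (-2 * Φ p) * Real.sqrt (metric K p).det : ℝ) := by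
  obtain ⟨C₁, hC₁, h₁⟩ := mukai_spinor₁ (dc := dc) (dt := dt) (ds := ds)
  obtain ⟨C₂, hC₂, h₂⟩ := mukai_spinor₂ (dc := dc) (dt := dt) (ds := ds)
  have hinj (a b : ℂ) : a • coordVol dc dt ds = b • coordVol dc dt ds ↔ a = b :=
    (smul_left_injective ℂ coordVol_ne_zero).eq_iff
  constructor
  · rintro ⟨κ₁, κ₂, hκ₁, hκ₂, h⟩
    refine ⟨κ₁ * C₁, κ₂ * C₂, mul_ne_zero hκ₁ hC₁, mul_ne_zero hκ₂ hC₂, fun p hp => ?_⟩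
    have hp' := h p hp
    rwa [h₁ K p (contDiffAt_two hU hK hp), h₂ K p (contDiffAt_two hU hK hp), smul_smul, smul_smul,
      hinj, hinj, ← mul_assoc, ← mul_assoc] at hp'
  · rintro ⟨κ₁, κ₂, hκ₁, hκ₂, h⟩
    refine ⟨κ₁ * C₁⁻¹, κ₂ * C₂⁻¹, mul_ne_zero hκ₁ (inv_ne_zero hC₁),
      mul_ne_zero hκ₂ (inv_ne_zero hC₂), fun p hp => ?_⟩
    rw [h₁ K p (contDiffAt_two hU hK hp), h₂ K p (contDiffAt_two hU hK hp), smul_smul, smul_smul,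
      hinj, hinj, mul_assoc, inv_mul_cancel_left₀ hC₁, mul_assoc, inv_mul_cancel_left₀ hC₂]
    exact h p hp

/-- The common factor `u` cancels between pairing and volume, and what remains says that `e^{-2Φ} q`
is constant. The hypotheses isolate what each case has to supply. -/
theorem isDilaton_iff_log {U : Set (Pt dc dt ds)} {K : Pt dc dt ds → ℝ} (hU : IsOpen U)
    (hK : ContDiffOn ℝ ((⊤ : ℕ∞) : WithTop ℕ∞) K U) {u q : Pt dc dt ds → ℝ} {a₁ a₂ : ℂ} {k : ℝ}
    (ha₁ : a₁ ≠ 0) (ha₂ : a₂ ≠ 0) (hk : 0 < k) (hu : ∀ p ∈ U, 0 < u p) (hq : ∀ p ∈ U, 0 < q p)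
    (h₁ : ∀ p ∈ U, (leftMatrix K p).det = a₁ * u p)
    (h₂ : ∀ p ∈ U, (rightMatrix K p).det = a₂ * u p)
    (hg : ∀ p ∈ U, Real.sqrt (metric K p).det = k * u p * q p) (Φ : Pt dc dt ds → ℝ) :
    IsDilaton 0 0 U K Φ ↔ ∃ a : ℝ, ∀ p ∈ U, Φ p = 1 / 2 * Real.log (q p) + a := by
  rw [isDilaton_iff hU hK]
  constructor
  · rintro ⟨κ₁, κ₂, hκ₁, hκ₂, h⟩
    -- Norms in the first pairing equation give `‖κ₁ a₁‖ / k = e^{-2Φ} q`; the constant is read off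
    -- from its logarithm.
    refine ⟨-(1 / 2) * Real.log (‖κ₁ * a₁‖ / k), fun p hp => ?_⟩
    have hp1 := (h p hp).1
    have hup := hu p hp
    have hqp := hq p hp
    have he := Real.exp_pos (-2 * Φ p)
    rw [h₁ p hp, hg p hp, ← mul_assoc] at hp1
    have hn := congrArg (fun z : ℂ => ‖z‖) hp1
    simp only [norm_mul, Complex.norm_real, Real.norm_eq_abs] at hn
    rw [abs_of_pos hup, abs_of_pos he, abs_of_pos hk, abs_of_pos hqp] at hn
    have h3 : ‖κ₁ * a₁‖ / k = Real.exp (-2 * Φ p) * q p := by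
      rw [div_eq_iff hk.ne', norm_mul]
      exact mul_right_cancel₀ hup.ne' (by rw [hn]; ring)
    rw [h3, Real.log_mul he.ne' hqp.ne', Real.log_exp]
    ring
  · rintro ⟨a, ha⟩
    have he := Real.exp_pos (-2 * a)
    have hc : ((Real.exp (-2 * a) * k : ℝ) : ℂ) ≠ 0 :=
      Complex.ofReal_ne_zero.2 (mul_pos he hk).ne'
    have hval : ∀ p ∈ U, Real.exp (-2 * Φ p) * Real.sqrt (metric K p).det =
        Real.exp (-2 * a) * k * u p := by
      intro p hp
      have hqp := hq p hp
      have h3 : Real.exp (-2 * Φ p) = (q p)⁻¹ * Real.exp (-2 * a) := by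
        rw [ha p hp, show -2 * (1 / 2 * Real.log (q p) + a) = -Real.log (q p) + -2 * a by ring,
          Real.exp_add, Real.exp_neg, Real.exp_log hqp]
      rw [h3, hg p hp]
      field_simp
    -- The constants are chosen so that both sides equal `e^{-2a} k u`.
    refine ⟨(Real.exp (-2 * a) * k : ℝ) / a₁, (Real.exp (-2 * a) * k : ℝ) / a₂,
      div_ne_zero hc ha₁, div_ne_zero hc ha₂, fun p hp => ?_⟩
    rw [h₁ p hp, h₂ p hp, hval p hp, ← mul_assoc, ← mul_assoc, div_mul_cancel₀ _ ha₁,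
      div_mul_cancel₀ _ ha₂]
    push_cast
    exact ⟨rfl, rfl⟩

theorem sqrt_eq_of_ofReal_eq {x : ℝ} {C z : ℂ} (hx : 0 < x) (h : (x : ℂ) = C * z ^ 2) :
    Real.sqrt x = Real.sqrt ‖C‖ * ‖z‖ := by
  have hn := congrArg (fun z : ℂ => ‖z‖) h
  simp only [norm_mul, norm_pow, Complex.norm_real, Real.norm_eq_abs, abs_of_pos hx] at hn
  rw [hn, Real.sqrt_mul (norm_nonneg C), Real.sqrt_sq (norm_nonneg z)]

/-! ## The case without chiral and twisted chiral coordinates -/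

section Semichiral

variable {n : ℕ}

theorem det_leftMatrix_eq_detA (K : Pt 0 0 n → ℝ) (p : Pt 0 0 n) :
    (leftMatrix K p).det = detA K p := by
  let e : Fin n ⊕ Fin n ≃ Fin n ⊕ (Fin n ⊕ Fin 0) :=
    Equiv.sumCongr (Equiv.refl _) (Equiv.sumEmpty _ _).symm
  rw [← det_submatrix_equiv_self e, detA_eq]
  congr 1
  ext (i | i) (j | j) <;> rfl

theorem det_rightMatrix_eq_detB (K : Pt 0 0 n → ℝ) (p : Pt 0 0 n) :
    (rightMatrix K p).det = detB K p := by
  let e : Fin n ⊕ Fin n ≃ Fin n ⊕ (Fin n ⊕ Fin 0) :=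
    Equiv.sumCongr (Equiv.refl _) (Equiv.sumEmpty _ _).symm
  rw [← det_submatrix_equiv_self e, detB_eq]
  congr 1
  ext (i | i) (j | j) <;> rfl

theorem genMongeAmpere_semichiral_iff (α : ℝ) (U : Set (Pt 0 0 n)) (K : Pt 0 0 n → ℝ) :
    GenMongeAmpere 0 0 α U K ↔ ∀ p ∈ U, detA K p = α * detB K p := by
  rw [genMongeAmpere_iff]
  refine forall₂_congr fun p _ => ?_
  rw [det_neg, det_leftMatrix_eq_detA, det_rightMatrix_eq_detB]
  have : Fintype.card (Fin n ⊕ (Fin n ⊕ Fin 0)) = n + n := by simp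
  -- The matrix has even size, so its overall sign disappears from the determinant.
  rw [this, ← two_mul, pow_mul]
  simp

/-! ### Invariance of the semichiral equation under rescalings. -/

theorem scaleFactor_ne_zero {s : Idx dc dt ds → ℂ} (hs : ∀ j, s j ≠ 0) (A : Frame dc dt ds) :
    scaleFactor s A ≠ 0 := by
  intro h
  have h1 : scaleFactor s A = dz A s := by rw [dz_apply, scaleFactor]
  have h2 : dz (bar A) s = 0 := by rw [← conj_dz, ← h1, h, map_zero]
  rw [h1] at h
  rw [dz_apply] at h h2
  rw [base_bar, jF_bar] at h2
  apply hs (base A)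
  have hre : ((s (base A)).re : ℂ) = 0 := by linear_combination (h + h2) / 2
  have him : ((s (base A)).im : ℂ) = 0 := by
    linear_combination (-jF A / 2) * (h - h2) + ((s (base A)).im : ℂ) * jF_mul_self A
  exact Complex.ext (by exact_mod_cast hre) (by exact_mod_cast him)

theorem scale_surjective {s : Idx dc dt ds → ℂ} (hs : ∀ j, s j ≠ 0) :
    Function.Surjective (scale s) := fun p =>
  ⟨fun j => (s j)⁻¹ * p j, by ext j; simp [scale, hs j]⟩

theorem det_hess_rescale {ι : Type*} [Fintype ι] [DecidableEq ι] (b : ℝ) {s : Idx dc dt ds → ℂ}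
    (hs : ∀ j, s j ≠ 0) (K : Pt dc dt ds → ℝ) (p : Pt dc dt ds) (x y : ι → Frame dc dt ds) :
    ((hess (fun q => b * K (scale s q)) p).submatrix x y).det =
      (b : ℂ) ^ Fintype.card ι * ((∏ i, scaleFactor s (x i)) * ∏ i, scaleFactor s (y i)) *
        ((hess K (scale s p)).submatrix x y).det := by
  have h : (hess (fun q => b * K (scale s q)) p).submatrix x y =
      (b : ℂ) • (diagonal (fun i => scaleFactor s (x i)) * (hess K (scale s p)).submatrix x y *
        diagonal fun i => scaleFactor s (y i)) := by
    ext i j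
    rw [hess_const_mul b (fun q => K (scale s q))]
    simp only [submatrix_apply, Matrix.smul_apply, mul_diagonal, diagonal_mul, smul_eq_mul,
      hess_comp_scale hs]
    ring
  rw [h, det_smul, det_mul, det_mul, det_diagonal, det_diagonal]
  ring

/-- In `detA` and in `detB` each of the labels `l, l̄, r, r̄` occurs exactly once, as a row or as a
column. Both determinants therefore acquire the same nonzero factor `f`. -/
theorem genMongeAmpere_rescale_iff (α : ℝ) (U : Set (Pt 0 0 n)) (K : Pt 0 0 n → ℝ) {b : ℝ}
    {s : Idx 0 0 n → ℂ} (hb : b ≠ 0) (hs : ∀ j, s j ≠ 0) :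
    GenMongeAmpere 0 0 α U K ↔
      GenMongeAmpere 0 0 α (scale s ⁻¹' U) (fun q => b * K (scale s q)) := by
  rw [genMongeAmpere_semichiral_iff, genMongeAmpere_semichiral_iff]
  set f : ℂ := (b : ℂ) ^ Fintype.card (Fin n ⊕ Fin n) *
    ((∏ i, scaleFactor s (Sum.elim l rb i)) * ∏ i, scaleFactor s (Sum.elim lb r i)) with hf
  have hf0 : f ≠ 0 := by
    refine mul_ne_zero (pow_ne_zero _ (by exact_mod_cast hb)) (mul_ne_zero ?_ ?_) <;>
      exact Finset.prod_ne_zero_iff.2 fun i _ => scaleFactor_ne_zero hs _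
  have hA (p : Pt 0 0 n) : detA (fun q => b * K (scale s q)) p = f * detA K (scale s p) := by
    rw [detA_eq, detA_eq, det_hess_rescale b hs]
  have hB (p : Pt 0 0 n) : detB (fun q => b * K (scale s q)) p = f * detB K (scale s p) := by
    rw [detB_eq, detB_eq, det_hess_rescale b hs, hf]
    simp only [Fintype.prod_sum_type, Sum.elim_inl, Sum.elim_inr]
    ring
  simp only [hA, hB]
  have hiff (p : Pt 0 0 n) : f * detA K (scale s p) = α * (f * detB K (scale s p)) ↔
      detA K (scale s p) = α * detB K (scale s p) := by
    rw [mul_left_comm, mul_right_inj' hf0]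
  simp only [hiff, Set.mem_preimage]
  exact ⟨fun h p hp => h _ hp, fun h p hp => by
    obtain ⟨q, rfl⟩ := scale_surjective hs p
    exact h q hp⟩

/-! ### Reality and constant sign of `detA`, and the semichiral dilatons. -/

theorem conj_detA {K : Pt dc dt ds → ℝ} {p : Pt dc dt ds} (hK : ContDiffAt ℝ 2 K p) :
    (starRingEnd ℂ) (detA K p) = detA K p := by
  -- Conjugation turns the rows `l, r̄` into `l̄, r`, which are the columns; by symmetry of the
  -- Hessian the result is the transpose.
  rw [detA_eq, RingHom.map_det, ← det_transpose]
  congr 1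
  ext i j
  have h (A B : Frame dc dt ds) : (starRingEnd ℂ) (hess K p A B) = hess K p (bar B) (bar A) :=
    (conj_hess hK A B).trans (hess_symm hK _ _)
  rcases i with i | i <;> rcases j with j | j <;> exact h _ _

theorem continuousOn_detA {U : Set (Pt dc dt ds)} {K : Pt dc dt ds → ℝ} (hU : IsOpen U)
    (hK : ContDiffOn ℝ ((⊤ : ℕ∞) : WithTop ℕ∞) K U) : ContinuousOn (detA K) U := by
  have h : ContinuousOn
      (fun p => (hess K p).submatrix (Sum.elim l rb : Fin ds ⊕ Fin ds → _) (Sum.elim lb r)) U :=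
    continuousOn_pi.2 fun i => continuousOn_pi.2 fun j => continuousOn_hess hU hK _ _
  refine ((continuous_id.matrix_det).comp_continuousOn h).congr fun p _ => ?_
  exact detA_eq K p

theorem exists_sign_of_preconnected {X : Type*} [TopologicalSpace X] {U : Set X}
    (hU : IsPreconnected U) {f : X → ℝ} (hf : ContinuousOn f U) (h0 : ∀ x ∈ U, f x ≠ 0) :
    ∃ ε : ℝ, ε ≠ 0 ∧ ∀ x ∈ U, f x = ε * |f x| := by
  by_cases h : ∃ x ∈ U, f x < 0
  · obtain ⟨x, hx, hfx⟩ := h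
    refine ⟨-1, by norm_num, fun y hy => ?_⟩
    have : f y < 0 := by
      by_contra! hy0
      obtain ⟨z, hz, hfz⟩ := hU.intermediate_value hx hy hf ⟨hfx.le, hy0⟩
      exact h0 z hz hfz
    rw [abs_of_neg this]
    ring
  · push Not at h
    exact ⟨1, one_ne_zero, fun y hy => by rw [abs_of_nonneg (h y hy), one_mul]⟩

theorem ratio_real_and_isDilaton_iff {U : Set (Pt 0 0 n)} {K : Pt 0 0 n → ℝ}
    (hpot : IsPotential U K) {α : ℝ} (hα : 0 < α) (hMA : GenMongeAmpere 0 0 α U K) :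
    (∀ p ∈ U, (detA K p / (KLR K p).det).im = 0 ∧ (detA K p / (KLR K p).det).re ≠ 0) ∧
      ∀ Φ : Pt 0 0 n → ℝ, (IsDilaton 0 0 U K Φ ↔ ∃ a : ℝ, ∀ p ∈ U,
        Φ p = 1 / 2 * Real.log |(detA K p / (KLR K p).det).re| + a) := by
  have hU := hpot.isOpen
  have hK := hpot.smooth
  rw [genMongeAmpere_semichiral_iff] at hMA
  obtain ⟨C, hC, hmetric⟩ := det_metric_semichiral (n := n)
  have hα' : (α : ℂ) ≠ 0 := Complex.ofReal_ne_zero.2 hα.ne'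
  have hpos : ∀ p ∈ U, 0 < (metric K p).det := fun p hp => (hpot.posDef p hp).det_pos
  have hB : ∀ p ∈ U, detB K p = (α : ℂ)⁻¹ * detA K p := fun p hp => by
    rw [hMA p hp, inv_mul_cancel_left₀ hα']
  -- If `detA` vanished, the determinant formula would make the metric degenerate.
  have hA0 : ∀ p ∈ U, detA K p ≠ 0 := by
    intro p hp h0
    have h := hmetric K p (contDiffAt_two hU hK hp) (hpot.det_ne p hp)
    rw [h0, zero_mul, zero_pow two_ne_zero, mul_zero] at h
    exact mul_ne_zero (Complex.ofReal_ne_zero.2 (hpos p hp).ne')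
      (pow_ne_zero 2 (hpot.det_ne p hp)) h
  have hAre : ∀ p ∈ U, ((detA K p).re : ℂ) = detA K p := fun p hp =>
    Complex.conj_eq_iff_re.1 (conj_detA (contDiffAt_two hU hK hp))
  have hratio : ∀ p ∈ U, (((detA K p / (KLR K p).det).re : ℝ) : ℂ) = detA K p / (KLR K p).det := by
    intro p hp
    refine Complex.conj_eq_iff_re.1 ?_
    rw [map_div₀, conj_detA (contDiffAt_two hU hK hp),
      (conjEquivariant_KLR (contDiffAt_two hU hK hp)).conj_det]
  have hratio0 : ∀ p ∈ U, (detA K p / (KLR K p).det).re ≠ 0 := by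
    intro p hp h0
    have h := hratio p hp
    rw [h0, Complex.ofReal_zero] at h
    exact div_ne_zero (hA0 p hp) (hpot.det_ne p hp) h.symm
  refine ⟨fun p hp => ⟨?_, hratio0 p hp⟩, fun Φ => ?_⟩
  · rw [← hratio p hp, Complex.ofReal_im]
  have hre0 : ∀ p ∈ U, (detA K p).re ≠ 0 := fun p hp h0 => hA0 p hp (by
    rw [← hAre p hp, h0, Complex.ofReal_zero])
  -- Connectedness of `U` is used here: the pairing must be a constant multiple of `|detA|`, so the
  -- sign of `detA` may not vary.
  obtain ⟨ε, hε, hsign⟩ := exists_sign_of_preconnected hpot.connected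
    (Complex.continuous_re.comp_continuousOn (continuousOn_detA hU hK)) hre0
  have hε' : (ε : ℂ) ≠ 0 := Complex.ofReal_ne_zero.2 hε
  have hsign' : ∀ p ∈ U, detA K p = ε * (|(detA K p).re| : ℝ) := fun p hp => by
    have h := hsign p hp
    simp only [Function.comp] at h
    rw [← Complex.ofReal_mul, ← h, hAre p hp]
  have hnorm : ∀ p ∈ U, ‖detA K p‖ = |(detA K p).re| := fun p hp => by
    rw [← Real.norm_eq_abs, ← Complex.norm_real, hAre p hp]
  refine isDilaton_iff_log hU hK (u := fun p => |(detA K p).re|)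
    (q := fun p => |(detA K p / (KLR K p).det).re|) (a₁ := ε) (a₂ := (α : ℂ)⁻¹ * ε)
    (k := Real.sqrt ‖C‖ * α⁻¹) hε' (mul_ne_zero (inv_ne_zero hα') hε') ?_ ?_ ?_ ?_ ?_ ?_ Φ
  · exact mul_pos (Real.sqrt_pos.2 (norm_pos_iff.2 hC)) (inv_pos.2 hα)
  · exact fun p hp => abs_pos.2 (hre0 p hp)
  · exact fun p hp => abs_pos.2 (hratio0 p hp)
  · exact fun p hp => by rw [det_leftMatrix_eq_detA, ← hsign' p hp]
  · exact fun p hp => by rw [det_rightMatrix_eq_detB, hB p hp, mul_assoc, ← hsign' p hp]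
  · intro p hp
    have hP := hpot.det_ne p hp
    -- Substituting `detB = α⁻¹ detA` exhibits `det g` as a constant times the square of `detA`
    -- times the ratio; these become `u` and `q`.
    have hm : ((metric K p).det : ℂ) =
        C * ((α : ℂ)⁻¹ * detA K p * (detA K p / (KLR K p).det)) ^ 2 := by
      have h := hmetric K p (contDiffAt_two hU hK hp) hP
      rw [hB p hp] at h
      rw [eq_div_of_mul_eq (pow_ne_zero 2 hP) h]
      field_simp
    rw [sqrt_eq_of_ofReal_eq (hpos p hp) hm, norm_mul, norm_mul, norm_inv, Complex.norm_real,
      Real.norm_of_nonneg hα.le, hnorm p hp, ← hratio p hp, Complex.norm_real, Real.norm_eq_abs,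
      Complex.ofReal_re]
    ring

end Semichiral

/-! ## The case without semichiral coordinates -/

section Chiral

variable {m n : ℕ}

theorem det_leftMatrix_eq_det_Ktt (K : Pt m n 0 → ℝ) (p : Pt m n 0) :
    (leftMatrix K p).det = (Ktt K p).det ∧ (-leftMatrix K p).det = (-Ktt K p).det := by
  let e : Fin n ≃ Fin 0 ⊕ (Fin 0 ⊕ Fin n) :=
    ((Equiv.emptySum _ _).trans (Equiv.emptySum _ _)).symm
  constructor <;> rw [← det_submatrix_equiv_self e] <;> rfl

theorem det_rightMatrix_eq_det_Kcc (K : Pt m n 0 → ℝ) (p : Pt m n 0) :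
    (rightMatrix K p).det = (Kcc K p).det := by
  let e : Fin m ≃ Fin 0 ⊕ (Fin 0 ⊕ Fin m) :=
    ((Equiv.emptySum _ _).trans (Equiv.emptySum _ _)).symm
  rw [← det_submatrix_equiv_self e]
  rfl

theorem genMongeAmpere_chiral_iff (α : ℝ) (U : Set (Pt m n 0)) (K : Pt m n 0 → ℝ) :
    GenMongeAmpere 0 0 α U K ↔ ∀ p ∈ U, (-Ktt K p).det = α * (Kcc K p).det := by
  rw [genMongeAmpere_iff]
  refine forall₂_congr fun p _ => ?_
  rw [(det_leftMatrix_eq_det_Ktt K p).2, det_rightMatrix_eq_det_Kcc, Nat.zero_mul, pow_zero,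
    one_mul]

/-! ### Rescalings and dilatons without semichiral coordinates. -/

theorem Kcc_const_mul (b : ℝ) (K : Pt dc dt ds → ℝ) (p : Pt dc dt ds) :
    Kcc (fun q => b * K q) p = (b : ℂ) • Kcc K p := by
  rw [Kcc, hess_const_mul]; rfl

theorem Ktt_const_mul (b : ℝ) (K : Pt dc dt ds → ℝ) (p : Pt dc dt ds) :
    Ktt (fun q => b * K q) p = (b : ℂ) • Ktt K p := by
  rw [Ktt, hess_const_mul]; rfl

theorem genMongeAmpere_one_iff (U : Set (Pt m n 0)) (K : Pt m n 0 → ℝ) :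
    GenMongeAmpere 0 0 1 U K ↔ ∀ p ∈ U, (Kcc K p).det = (-Ktt K p).det := by
  rw [genMongeAmpere_chiral_iff]
  refine forall₂_congr fun p _ => ?_
  rw [Complex.ofReal_one, one_mul, eq_comm]

/-- Replacing `K` by `β K` multiplies the chiral determinant by `β ^ m` and the twisted chiral one
by `β ^ n`; the hypothesis on `β` says that their quotient is `α`. -/
theorem genMongeAmpere_iff_const_mul (U : Set (Pt m n 0)) (K : Pt m n 0 → ℝ) {α β : ℝ}
    (hβ : β ≠ 0) (h : β ^ m = α * β ^ n) :
    GenMongeAmpere 0 0 α U K ↔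
      ∀ p ∈ U, (Kcc (fun q => β * K q) p).det = (-Ktt (fun q => β * K q) p).det := by
  rw [genMongeAmpere_chiral_iff]
  refine forall₂_congr fun p _ => ?_
  have hβ' : ((β : ℂ) ^ n) ≠ 0 := pow_ne_zero n (Complex.ofReal_ne_zero.2 hβ)
  have h' : (β : ℂ) ^ m = α * β ^ n := by exact_mod_cast h
  rw [Kcc_const_mul, Ktt_const_mul, ← smul_neg, det_smul, det_smul, Fintype.card_fin,
    Fintype.card_fin, h', mul_comm (α : ℂ) (_ ^ _), mul_assoc, mul_right_inj' hβ', eq_comm]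

/-- Rescaling `χ` leaves `K_{cc̄}` unchanged and multiplies `K_{tt̄}` by `μ * μ`, so the twisted
chiral determinant acquires `(μ * μ) ^ n = α⁻¹`. -/
theorem genMongeAmpere_iff_scaleChi (U : Set (Pt m n 0)) (K : Pt m n 0 → ℝ) {α μ : ℝ}
    (hμ : μ ≠ 0) (h : α * (μ * μ) ^ n = 1) :
    GenMongeAmpere 0 0 α U K ↔ ∀ p ∈ scaleChi μ ⁻¹' U,
      (Kcc (fun q => K (scaleChi μ q)) p).det = (-Ktt (fun q => K (scaleChi μ q)) p).det := by
  set s : Idx m n 0 → ℂ := Sum.elim (fun _ => 1) (Sum.elim (fun _ => 1) (fun _ => (μ : ℂ))) with hs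
  have hs0 : ∀ j, s j ≠ 0 := by
    rintro (j | j | j) <;> simp [hs, hμ]
  have hscale : (scaleChi μ : Pt m n 0 → Pt m n 0) = scale s := rfl
  have h' : (α : ℂ) * (μ * μ : ℂ) ^ n = 1 := by exact_mod_cast h
  have hμ' : ((μ * μ : ℂ) ^ n) ≠ 0 := right_ne_zero_of_mul_eq_one h'
  have hc (p : Pt m n 0) : Kcc (fun q => K (scale s q)) p = Kcc K (scale s p) := by
    ext i j
    simp only [Kcc, submatrix_apply, hess_comp_scale hs0]
    simp [scaleFactor, hs, c, cb, fC, base]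
  have ht (p : Pt m n 0) :
      Ktt (fun q => K (scale s q)) p = (μ * μ : ℂ) • Ktt K (scale s p) := by
    ext i j
    simp only [Ktt, submatrix_apply, hess_comp_scale hs0, Matrix.smul_apply, smul_eq_mul]
    simp [scaleFactor, hs, t, tb, fT, base]
  rw [genMongeAmpere_chiral_iff, hscale]
  simp only [hc, ht]
  have hiff (p : Pt m n 0) : (Kcc K p).det = (-((μ * μ : ℂ) • Ktt K p)).det ↔
      (-Ktt K p).det = α * (Kcc K p).det := by
    rw [← smul_neg, det_smul, Fintype.card_fin]
    constructor
    · intro h1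
      rw [h1, ← mul_assoc, h', one_mul]
    · intro h1
      rw [h1, ← mul_assoc, mul_comm ((μ * μ : ℂ) ^ n), h', one_mul]
  simp only [hiff, Set.mem_preimage]
  exact ⟨fun h p hp => h _ hp, fun h p hp => by
    obtain ⟨q, rfl⟩ := scale_surjective hs0 p
    exact h q hp⟩

theorem det_Kcc_pos_and_isDilaton_iff {U : Set (Pt m n 0)} {K : Pt m n 0 → ℝ}
    (hpot : IsPotential U K) {α : ℝ} (hα : 0 < α) (hMA : GenMongeAmpere 0 0 α U K) :
    (∀ p ∈ U, (Kcc K p).det.im = 0 ∧ 0 < (Kcc K p).det.re) ∧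
      ∀ Φ : Pt m n 0 → ℝ, (IsDilaton 0 0 U K Φ ↔ ∃ a : ℝ, ∀ p ∈ U,
        Φ p = 1 / 2 * Real.log (Kcc K p).det.re + a) := by
  have hU := hpot.isOpen
  have hK := hpot.smooth
  rw [genMongeAmpere_chiral_iff] at hMA
  obtain ⟨C, hC, hmetric⟩ := det_metric_of_no_semichiral (m := m) (n := n)
  have hα' : (α : ℂ) ≠ 0 := Complex.ofReal_ne_zero.2 hα.ne'
  have hpos : ∀ p ∈ U, 0 < (metric K p).det := fun p hp => (hpot.posDef p hp).det_pos
  have hKcc : ∀ p ∈ U, 0 < (Kcc K p).det.re ∧ (Kcc K p).det.im = 0 := fun p hp =>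
    posDef_Kcc (contDiffAt_two hU hK hp) (hpot.posDef p hp)
  have hre : ∀ p ∈ U, (Kcc K p).det = ((Kcc K p).det.re : ℂ) := fun p hp =>
    Complex.ext (by simp) (by simp [(hKcc p hp).2])
  have hKtt : ∀ p ∈ U, (Ktt K p).det = (-1) ^ n * α * ((Kcc K p).det.re : ℂ) := by
    intro p hp
    rw [mul_assoc, ← hre p hp, ← hMA p hp, det_neg, Fintype.card_fin, ← mul_assoc, ← mul_pow]
    simp
  refine ⟨fun p hp => ⟨(hKcc p hp).2, (hKcc p hp).1⟩, fun Φ => ?_⟩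
  -- The equation gives `det K_{tt̄} = (-1)^n α det K_{cc̄}`, so `√(det g)` is a constant times
  -- `(det K_{cc̄}) ^ 2`, and `det K_{cc̄}` serves both as `u` and as `q`.
  refine isDilaton_iff_log hU hK (u := fun p => (Kcc K p).det.re)
    (q := fun p => (Kcc K p).det.re) (a₁ := (-1) ^ n * α) (a₂ := 1) (k := Real.sqrt ‖C‖ * α)
    (by simp [hα.ne']) one_ne_zero (mul_pos (Real.sqrt_pos.2 (norm_pos_iff.2 hC)) hα)
    (fun p hp => (hKcc p hp).1) (fun p hp => (hKcc p hp).1) ?_ ?_ ?_ Φ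
  · exact fun p hp => by rw [(det_leftMatrix_eq_det_Ktt K p).1, hKtt p hp]
  · exact fun p hp => by rw [det_rightMatrix_eq_det_Kcc, one_mul, ← hre p hp]
  · intro p hp
    rw [sqrt_eq_of_ofReal_eq (hpos p hp) (hmetric K p (contDiffAt_two hU hK hp)), hKtt p hp,
      norm_mul, norm_mul, norm_mul, norm_pow, norm_neg, norm_one, one_pow, one_mul, hre p hp]
    simp only [Complex.norm_real, Real.norm_eq_abs, abs_of_pos hα, abs_of_pos (hKcc p hp).1,
      Complex.ofReal_re]
    ring

theorem pow_rpow_inv_sub {α : ℝ} (hα : 0 < α) (hmn : m ≠ n) :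
    (α ^ (((m : ℝ) - n)⁻¹)) ^ m = α * (α ^ (((m : ℝ) - n)⁻¹)) ^ n := by
  have h : (m : ℝ) - n ≠ 0 := sub_ne_zero.2 (Nat.cast_injective.ne hmn)
  rw [← Real.rpow_natCast, ← Real.rpow_natCast, ← Real.rpow_mul hα.le, ← Real.rpow_mul hα.le]
  conv_rhs => rw [← Real.rpow_one α, ← Real.rpow_mul hα.le, ← Real.rpow_add hα]
  congr 1
  field_simp
  ring

theorem mul_rpow_neg_inv_pow {α : ℝ} (hα : 0 < α) (hn : 0 < n) :
    α * (α ^ (-(2 * (n : ℝ))⁻¹) * α ^ (-(2 * (n : ℝ))⁻¹)) ^ n = 1 := by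
  have h : (n : ℝ) ≠ 0 := Nat.cast_ne_zero.2 hn.ne'
  rw [← Real.rpow_add hα, ← Real.rpow_natCast, ← Real.rpow_mul hα.le]
  have : (-(2 * (n : ℝ))⁻¹ + -(2 * (n : ℝ))⁻¹) * n = -1 := by
    field_simp
    ring
  rw [this, Real.rpow_neg_one, mul_inv_cancel₀ hα.ne']

end Chiral

end GenCY

/-! ### The four cases assembled. -/

theorem mainTheorem4 :
    -- Kähler case
    (∀ (n : ℕ) (U : Set (Pt n 0 0)) (K : Pt n 0 0 → ℝ), IsOpen U →
      ContDiffOn ℝ ((⊤ : ℕ∞) : WithTop ℕ∞) K U →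
      (GenMongeAmpere 0 0 1 U K ↔ ∀ p ∈ U, (Kcc K p).det = 1) ∧
      (∀ α : ℝ, 0 < α →
        (0 < n →
          (GenMongeAmpere 0 0 α U K ↔
            ∀ p ∈ U, (Kcc (fun q => α ^ ((n : ℝ)⁻¹) * K q) p).det = 1)) ∧
        (IsPotential U K → GenMongeAmpere 0 0 α U K → ∀ Φ : Pt n 0 0 → ℝ,
          (IsDilaton 0 0 U K Φ ↔ ∃ a : ℝ, ∀ p ∈ U, Φ p = a)))) ∧
    -- the case without chiral and twisted chiral coordinates
    (∀ (n : ℕ) (U : Set (Pt 0 0 n)) (K : Pt 0 0 n → ℝ), IsOpen U →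
      ContDiffOn ℝ ((⊤ : ℕ∞) : WithTop ℕ∞) K U → ∀ α : ℝ, 0 < α →
      (GenMongeAmpere 0 0 α U K ↔ ∀ p ∈ U, detA K p = α * detB K p) ∧
      (∀ (b : ℝ) (s : Idx 0 0 n → ℂ), b ≠ 0 → (∀ j, s j ≠ 0) →
        (GenMongeAmpere 0 0 α U K ↔
          GenMongeAmpere 0 0 α (scale s ⁻¹' U) (fun q => b * K (scale s q)))) ∧
      (IsPotential U K → GenMongeAmpere 0 0 α U K →
        (∀ p ∈ U, (detA K p / (KLR K p).det).im = 0 ∧ (detA K p / (KLR K p).det).re ≠ 0) ∧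
        ∀ Φ : Pt 0 0 n → ℝ,
          (IsDilaton 0 0 U K Φ ↔ ∃ a : ℝ, ∀ p ∈ U,
            Φ p = 1 / 2 * Real.log |(detA K p / (KLR K p).det).re| + a))) ∧
    -- the case without semichiral coordinates
    (∀ (m n : ℕ) (U : Set (Pt m n 0)) (K : Pt m n 0 → ℝ), IsOpen U →
      ContDiffOn ℝ ((⊤ : ℕ∞) : WithTop ℕ∞) K U →
      (GenMongeAmpere 0 0 1 U K ↔ ∀ p ∈ U, (Kcc K p).det = (-Ktt K p).det) ∧
      (∀ α : ℝ, 0 < α →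
        (m ≠ n →
          (GenMongeAmpere 0 0 α U K ↔ ∀ p ∈ U,
            (Kcc (fun q => α ^ (((m : ℝ) - n)⁻¹) * K q) p).det =
              (-Ktt (fun q => α ^ (((m : ℝ) - n)⁻¹) * K q) p).det)) ∧
        (0 < n →
          (GenMongeAmpere 0 0 α U K ↔ ∀ p ∈ scaleChi (α ^ (-(2 * (n : ℝ))⁻¹)) ⁻¹' U,
            (Kcc (fun q => K (scaleChi (α ^ (-(2 * (n : ℝ))⁻¹)) q)) p).det =
              (-Ktt (fun q => K (scaleChi (α ^ (-(2 * (n : ℝ))⁻¹)) q)) p).det)) ∧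
        (IsPotential U K → GenMongeAmpere 0 0 α U K →
          (∀ p ∈ U, (Kcc K p).det.im = 0 ∧ 0 < (Kcc K p).det.re) ∧
          ∀ Φ : Pt m n 0 → ℝ,
            (IsDilaton 0 0 U K Φ ↔ ∃ a : ℝ, ∀ p ∈ U,
              Φ p = 1 / 2 * Real.log (Kcc K p).det.re + a)))) ∧
    -- the N = (4,4) condition
    (∀ (n : ℕ) (U : Set (Pt n n 0)) (K : Pt n n 0 → ℝ), IsOpen U →
      ContDiffOn ℝ ((⊤ : ℕ∞) : WithTop ℕ∞) K U →
      (∀ p ∈ U, Kcc K p + Ktt K p = 0) →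
        (∀ p ∈ U, (Kcc K p).det = (-Ktt K p).det) ∧ GenMongeAmpere 0 0 1 U K) := by
  refine ⟨?_, ?_, ?_, ?_⟩
  · intro n U K hU hK
    -- The Kähler case is the chiral case with an empty twisted chiral block, whose determinant is
    -- `1`.
    have hKtt (p : Pt n 0 0) : (-Ktt K p).det = 1 := Matrix.det_isEmpty
    refine ⟨?_, fun α hα => ⟨fun hn => ?_, fun hpot hMA Φ => ?_⟩⟩
    · rw [genMongeAmpere_one_iff]
      simp only [hKtt]
    · have hn' : (n : ℝ) ≠ 0 := Nat.cast_ne_zero.2 hn.ne'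
      rw [genMongeAmpere_iff_const_mul U K (β := α ^ ((n : ℝ)⁻¹)) (Real.rpow_pos_of_pos hα _).ne'
        (by rw [Real.rpow_inv_natCast_pow hα.le hn.ne', pow_zero, mul_one])]
      simp only [Matrix.det_isEmpty]
    · rw [(det_Kcc_pos_and_isDilaton_iff hpot hα hMA).2 Φ]
      rw [genMongeAmpere_chiral_iff] at hMA
      -- The equation itself fixes `det K_{cc̄}`, so the logarithm in the general dilaton formula is
      -- constant and can be moved into `a`.
      have hdet : ∀ p ∈ U, (Kcc K p).det.re = α⁻¹ := by
        intro p hp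
        have h := hMA p hp
        rw [hKtt] at h
        have h' : (Kcc K p).det = ((α⁻¹ : ℝ) : ℂ) := by
          rw [Complex.ofReal_inv]
          exact eq_inv_of_mul_eq_one_right h.symm
        rw [h', Complex.ofReal_re]
      constructor
      · rintro ⟨a, ha⟩
        exact ⟨1 / 2 * Real.log α⁻¹ + a, fun p hp => by rw [ha p hp, hdet p hp]⟩
      · rintro ⟨a, ha⟩
        exact ⟨a - 1 / 2 * Real.log α⁻¹, fun p hp => by rw [ha p hp, hdet p hp]; ring⟩
  · intro n U K _ _ α hα
    exact ⟨genMongeAmpere_semichiral_iff α U K,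
      fun b s hb hs => genMongeAmpere_rescale_iff α U K hb hs,
      fun hpot hMA => ratio_real_and_isDilaton_iff hpot hα hMA⟩
  · intro m n U K _ _
    refine ⟨genMongeAmpere_one_iff U K, fun α hα => ⟨fun hmn => ?_, fun hn => ?_,
      fun hpot hMA => det_Kcc_pos_and_isDilaton_iff hpot hα hMA⟩⟩
    · exact genMongeAmpere_iff_const_mul U K (Real.rpow_pos_of_pos hα _).ne'
        (pow_rpow_inv_sub hα hmn)
    · exact genMongeAmpere_iff_scaleChi U K (Real.rpow_pos_of_pos hα _).ne'
        (mul_rpow_neg_inv_pow hα hn)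
  · intro n U K _ _ h
    have hdet : ∀ p ∈ U, (Kcc K p).det = (-Ktt K p).det := fun p hp => by
      rw [eq_neg_of_add_eq_zero_left (h p hp)]
    exact ⟨hdet, (genMongeAmpere_one_iff U K).2 hdet⟩
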